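/- Let $N\ge 1$ and $\mathcal V=\{1,\dots,N\}$. Vehicle $i\in\mathcal V$ has linear dynamics $\dot x_i=A_ix_i+B_i\alpha_i$ with state $x_i\in\mathbb R^{n_i}$, control $\alpha_i\in\mathcal A_i$, and $\mathcal A_i\subset\mathbb R^{m_i}$ convex. For $s\in[0,T]$, $T>0$, its Hamiltonian is $$H_i(s,x_i,p_i)=-x_i^\top A_i^\top p_i+\sup_{\alpha_i\in\mathcal A_i}\langle -B_i\alpha_i,p_i\rangle .$$ For $i,j\in\mathcal V$ let $\Omega_{i,j}=\{x_i\in\mathbb R^{n_i}: J_{i,j}(x_i)\le 0\}$ be the goal sets, with $J_{i,j}:\mathbb R^{n_i}\to\mathbb R$, and let $$\Theta=\{x=(x_1,\dots,x_N)\in\mathbb R^{n}:\ \exists\,\sigma\in\mathcal S_N\ \forall i\in\mathcal V,\ x_i\in\Omega_{i,\sigma(i)}\},\qquad n=n_1+\dots+n_N,$$ where $\mathcal S_N$ is the set of permutations of $\mathcal V$. Assume for all $i,j$: 1. $H_i$ is real-valued and continuous on $[0,T]\times\mathbb R^{n_i}\times\mathbb R^{n_i}$. 2. There is $c_i>0$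 such that $|H_i(s,x,p')-H_i(s,x,p'')|\le c_i(1+\|x\|)\|p'-p''\|$ and $|H_i(s,x,0)|\le c_i(1+\|x\|)$ for all $s\in[0,T]$ and $x,p',p''\in\mathbb R^{n_i}$. 3. For every compact $M\subset\mathbb R^{n_i}$ there is $\kappa_i(M)>0$ such that $|H_i(s,x',p)-H_i(s,x'',p)|\le\kappa_i(M)(1+\|p\|)\|x'-x''\|$ for all $x',x''\in M$, $s\in[0,T]$ and $p\in\mathbb R^{n_i}$. 4. $J_{i,j}$ is continuous. A viscosity solution on $[0,T]$ of an initial value problem is understood to be a function that is continuous on (state space) $\times[0,T]$, attains the initial data at $s=0$, and satisfies the equation on (state space) $\times(0,T)$ in the viscosity sense (with $C^1$ test functions). Then: (a) For all $i,j\in\mathcal V$ the problem $$\partial_s\phi_{i,j}(x_i,s)+H_i(s,x_i,\nabla_{x_i}\phi_{i,j}(x_i,s))=0,\qquad \phi_{i,j}(x_i,0)=J_{i,j}(x_i),$$ has a unique viscosity solution $\phi_{i,j}$ on $\mathbb R^{n_i}\times[0,T]$. (b) There is a function $J:\mathbb R^n\to\mathbb R$ with $\Theta=\{x\in\mathbb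 R^n:J(x)\le0\}$, namely $J(x)=\min_{\sigma\in\mathcal S_N}\max_{i\in\mathcal V}J_{i,\sigma(i)}(x_i)$, such that $$\varphi(x,s)=\min_{\sigma\in\mathcal S_N}\max_{i\in\mathcal V}\phi_{i,\sigma(i)}(x_i,s)$$ is the unique viscosity solution on $\mathbb R^n\times[0,T]$ of the joint problem $$\partial_s\varphi(x,s)+\sum_{i=1}^N H_i(s,x_i,\nabla_{x_i}\varphi(x,s))=0,\qquad \varphi(x,0)=J(x).$$ -/

import Mathlib

open Set Topology

open scoped InnerProductSpace

noncomputable section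

/-! ### Viscosity solutions of `∂ₛu + H(s, x, ∇ₓu) = 0`, `u(x, 0) = g(x)` -/

section Viscosity

variable {E : Type*} [NormedAddCommGroup E] [InnerProductSpace ℝ E] [CompleteSpace E]

/-- `u` satisfies `∂ₛu + H(s, x, ∇ₓu) ≤ 0` on `E × (0, T)` in the viscosity sense: whenever
`u - ψ` has a local maximum at `(x, s)` for a `C¹` test function `ψ`, the inequality holds
for `ψ` at that point. -/
def IsViscositySubsolution (T : ℝ) (H : ℝ → E → E → ℝ) (u : E → ℝ → ℝ) : Prop :=
  ∀ ψ : E → ℝ → ℝ, ContDiff ℝ 1 (fun z : E × ℝ => ψ z.1 z.2) →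
    ∀ x : E, ∀ s ∈ Ioo 0 T,
      IsLocalMax (fun z : E × ℝ => u z.1 z.2 - ψ z.1 z.2) (x, s) →
        deriv (fun r => ψ x r) s + H s x (gradient (fun y => ψ y s) x) ≤ 0

/-- `u` satisfies `∂ₛu + H(s, x, ∇ₓu) ≥ 0` on `E × (0, T)` in the viscosity sense. -/
def IsViscositySupersolution (T : ℝ) (H : ℝ → E → E → ℝ) (u : E → ℝ → ℝ) : Prop :=
  ∀ ψ : E → ℝ → ℝ, ContDiff ℝ 1 (fun z : E × ℝ => ψ z.1 z.2) →
    ∀ x : E, ∀ s ∈ Ioo 0 T,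
      IsLocalMin (fun z : E × ℝ => u z.1 z.2 - ψ z.1 z.2) (x, s) →
        0 ≤ deriv (fun r => ψ x r) s + H s x (gradient (fun y => ψ y s) x)

/-- `u` is a viscosity solution of the initial value problem
`∂ₛu + H(s, x, ∇ₓu) = 0` on `E × (0, T)`, `u(·, 0) = g`: it is continuous on `E × [0, T]`,
attains the initial data, and is both a viscosity sub- and supersolution. (Only the values of
`u` on `E × [0, T]` matter.) -/
structure IsViscositySolution (T : ℝ) (H : ℝ → E → E → ℝ) (g : E → ℝ) (u : E → ℝ → ℝ) :
    Prop where
  continuousOn : ContinuousOn (fun z : E × ℝ => u z.1 z.2) (univ ×ˢ Icc 0 T)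
  initial : ∀ x, u x 0 = g x
  subsolution : IsViscositySubsolution T H u
  supersolution : IsViscositySupersolution T H u

/-- `u` is a viscosity solution on `E × [0, T]`, and every viscosity solution coincides with `u`
on `E × [0, T]`. -/
def IsUniqueViscositySolution (T : ℝ) (H : ℝ → E → E → ℝ) (g : E → ℝ) (u : E → ℝ → ℝ) : Prop :=
  IsViscositySolution T H g u ∧
    ∀ v : E → ℝ → ℝ, IsViscositySolution T H g v → ∀ x, ∀ s ∈ Icc 0 T, v x s = u x s

/-- The regularity assumptions on a real-valued Hamiltonian on `[0, T] × E × E`. -/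
structure RegularHamiltonian (T : ℝ) (H : ℝ → E → E → ℝ) : Prop where
  continuousOn : ContinuousOn (fun z : ℝ × E × E => H z.1 z.2.1 z.2.2) (Icc 0 T ×ˢ univ)
  growth : ∃ c : ℝ, 0 < c ∧ ∀ s ∈ Icc 0 T, ∀ x : E,
    (∀ p q : E, |H s x p - H s x q| ≤ c * (1 + ‖x‖) * ‖p - q‖) ∧ |H s x 0| ≤ c * (1 + ‖x‖)
  lipschitz : ∀ M : Set E, IsCompact M → ∃ κ : ℝ, 0 < κ ∧
    ∀ x ∈ M, ∀ y ∈ M, ∀ s ∈ Icc 0 T, ∀ p : E,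
      |H s x p - H s y p| ≤ κ * (1 + ‖p‖) * ‖x - y‖

end Viscosity

/-! ### Vehicles with linear dynamics `ẋ = A x + B α`, `α ∈ 𝒜` -/

open Classical in
/-- The characteristic function of a set: `0` on the set and `+∞` off it. -/
def charFn {F : Type*} (S : Set F) (a : F) : EReal := if a ∈ S then 0 else ⊤

/-- The extended-real Hamiltonian of one vehicle,
`-xᵀAᵀp + sup_α (⟨-Bα, p⟩ - I_𝒜(α))`. -/
def vehicleHamiltonianE {n m : ℕ} (A : Matrix (Fin n) (Fin n) ℝ) (B : Matrix (Fin n) (Fin m) ℝ)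
    (𝒜 : Set (EuclideanSpace ℝ (Fin m))) (x p : EuclideanSpace ℝ (Fin n)) : EReal :=
  ((-⟪A.toEuclideanLin x, p⟫_ℝ : ℝ) : EReal) +
    ⨆ α : EuclideanSpace ℝ (Fin m), (((⟪-B.toEuclideanLin α, p⟫_ℝ : ℝ) : EReal) - charFn 𝒜 α)

/-- The Hamiltonian of one vehicle as a real-valued function of `(s, x, p)`. It is used only
when the extended-real Hamiltonian is finite everywhere. -/
def vehicleHamiltonian {n m : ℕ} (A : Matrix (Fin n) (Fin n) ℝ) (B : Matrix (Fin n) (Fin m) ℝ)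
    (𝒜 : Set (EuclideanSpace ℝ (Fin m))) (_s : ℝ) (x p : EuclideanSpace ℝ (Fin n)) : ℝ :=
  (vehicleHamiltonianE A B 𝒜 x p).toReal

/-! ### The joint system of `N` vehicles -/

/-- The joint state space `ℝ^(n₁) × ⋯ × ℝ^(n_N)`, with the Euclidean norm. -/
abbrev JointSpace {N : ℕ} (n : Fin N → ℕ) : Type :=
  PiLp 2 (fun i : Fin N => EuclideanSpace ℝ (Fin (n i)))

/-- The joint Hamiltonian `∑ᵢ Hᵢ(s, xᵢ, pᵢ)`. -/
def jointHamiltonian {N : ℕ} {n : Fin N → ℕ}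
    (H : ∀ i, ℝ → EuclideanSpace ℝ (Fin (n i)) → EuclideanSpace ℝ (Fin (n i)) → ℝ)
    (s : ℝ) (x p : JointSpace n) : ℝ :=
  ∑ i, H i s (x i) (p i)

/-- The permutation-invariant goal set: some assignment `σ` puts every vehicle `i` in
`Ω i (σ i)`. -/
def goalSet {N : ℕ} {n : Fin N → ℕ}
    (Ω : ∀ i : Fin N, Fin N → Set (EuclideanSpace ℝ (Fin (n i)))) : Set (JointSpace n) :=
  {x | ∃ σ : Equiv.Perm (Fin N), ∀ i, x i ∈ Ω i (σ i)}

/-- The value `min_σ max_i c i (σ i)` of the linear bottleneck assignment problem. -/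
def bottleneck {N : ℕ} [NeZero N] (c : Fin N → Fin N → ℝ) : ℝ :=
  (Finset.univ : Finset (Equiv.Perm (Fin N))).inf' Finset.univ_nonempty fun σ =>
    (Finset.univ : Finset (Fin N)).sup' Finset.univ_nonempty fun i => c i (σ i)

end

/-! Each `H_i` is the supremum of `-⟪A_i x + c, p⟫` over `c` in the image of the control set under
`B_i`. Finiteness makes this image nonempty and linear growth in `p` makes it bounded, so `H_i`
belongs to a control problem `ẋ = A_i x + c` with bounded controls (`IsControlHamiltonian`). Its
value function, the infimum of the cost at the end of the trajectories, is explicit through `exp (t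
A)`, and dynamic programming shows that it is a viscosity solution.

Uniqueness is by doubling of variables. The speed is at most `c (1 + ‖x‖)`, so only finitely distant
data matter in finite time; the barrier of `exists_barrier` turns this into a localisation to a
cylinder, and `comparison` needs no growth condition on the solutions.

The joint Hamiltonian has the same form, with block-diagonal field and product control set, so
existence and uniqueness apply to it too. The min-max formula is proved on trajectories, not on the
equation: the vehicles choose controls independently, so under a fixed assignment each can minimise
its own cost without hindering the others, and the minimum over assignments commutes with the
infimum over controls (`valueFunction_bottleneck`). By uniqueness the given solutions are the
individual values, hence their bottleneck is the joint value. -/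

noncomputable section

open MeasureTheory

/-! ### The linear flow and controlled trajectories -/

section Trajectory

set_option linter.unusedSectionVars false

variable {E : Type*} [NormedAddCommGroup E] [NormedSpace ℝ E] [CompleteSpace E]

/-- The flow `exp (t A)` of the linear equation `ẋ = A x`. -/
def linearFlow (A : E →L[ℝ] E) (t : ℝ) : E →L[ℝ] E := NormedSpace.exp (t • A)

theorem linearFlow_zero (A : E →L[ℝ] E) : linearFlow A 0 = 1 := by
  simp [linearFlow]

theorem linearFlow_add (A : E →L[ℝ] E) (s t : ℝ) :
    linearFlow A (s + t) = linearFlow A s * linearFlow A t := by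
  let _ : NormedAlgebra ℚ (E →L[ℝ] E) := NormedAlgebra.restrictScalars ℚ ℝ _
  unfold linearFlow
  rw [add_smul]
  exact NormedSpace.exp_add_of_commute (((Commute.refl A).smul_left s).smul_right t)

theorem hasDerivAt_linearFlow (A : E →L[ℝ] E) (t : ℝ) :
    HasDerivAt (linearFlow A) (A * linearFlow A t) t :=
  hasDerivAt_exp_smul_const' A t

theorem continuous_linearFlow (A : E →L[ℝ] E) : Continuous (linearFlow A) :=
  continuous_iff_continuousAt.2 fun t => (hasDerivAt_linearFlow A t).continuousAt

/-- The mean value inequality, used twice: the derivative `A (exp (t A) - 1)` of the second order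
remainder is itself `O(t)` by the first application. -/
theorem exists_linearFlow_bounds (A : E →L[ℝ] E) (T : ℝ) :
    ∃ K : ℝ, 0 ≤ K ∧ ∀ t ∈ Icc 0 T, ‖linearFlow A t‖ ≤ K ∧ ‖linearFlow A t - 1‖ ≤ K * t ∧
      ‖linearFlow A t - 1 - t • A‖ ≤ K * t ^ 2 := by
  obtain ⟨K, hK⟩ := (isCompact_Icc (a := (0 : ℝ)) (b := T)).exists_bound_of_continuousOn
    (continuous_linearFlow A).continuousOn
  have hA := norm_nonneg A
  by_cases hT : 0 ≤ T
  swap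
  · exact ⟨0, le_rfl, fun t ht => absurd (ht.1.trans ht.2) hT⟩
  have hK0 : 0 ≤ K := (norm_nonneg _).trans (hK 0 ⟨le_rfl, hT⟩)
  have h1 : ∀ t ∈ Icc 0 T, ‖linearFlow A t - 1‖ ≤ ‖A‖ * K * t := by
    intro t ht
    have := Convex.norm_image_sub_le_of_norm_hasDerivWithin_le (f := linearFlow A)
      (f' := fun t => A * linearFlow A t) (s := Icc 0 T) (C := ‖A‖ * K)
      (fun r _ => (hasDerivAt_linearFlow A r).hasDerivWithinAt)
      (fun r hr => (norm_mul_le _ _).trans (mul_le_mul_of_nonneg_left (hK r hr) hA))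
      (convex_Icc 0 T) ⟨le_rfl, hT⟩ ht
    simpa [linearFlow_zero, abs_of_nonneg ht.1] using this
  have h2 : ∀ t ∈ Icc 0 T, ‖linearFlow A t - 1 - t • A‖ ≤ ‖A‖ * (‖A‖ * K) * t ^ 2 := by
    intro t ht
    have := Convex.norm_image_sub_le_of_norm_hasDerivWithin_le
      (f := fun r : ℝ => linearFlow A r - 1 - r • A)
      (f' := fun r => A * (linearFlow A r - 1)) (s := Icc 0 t) (C := ‖A‖ * (‖A‖ * K * t))
      (fun r _ => by
        have h := ((hasDerivAt_linearFlow A r).sub_const 1).sub ((hasDerivAt_id r).smul_const A)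
        refine (h.congr_deriv ?_).hasDerivWithinAt
        simp [mul_sub])
      (fun r hr => by
        refine (norm_mul_le _ _).trans (mul_le_mul_of_nonneg_left ?_ hA)
        refine (h1 r ⟨hr.1, hr.2.trans ht.2⟩).trans ?_
        exact mul_le_mul_of_nonneg_left hr.2 (by positivity))
      (convex_Icc 0 t) ⟨le_rfl, ht.1⟩ ⟨ht.1, le_rfl⟩
    simp only [linearFlow_zero, sub_self, zero_smul, sub_zero, Real.norm_eq_abs,
      abs_of_nonneg ht.1] at this
    exact this.trans (le_of_eq (by ring))
  refine ⟨K + ‖A‖ * K + ‖A‖ * (‖A‖ * K), by positivity, fun t ht => ⟨?_, ?_, ?_⟩⟩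
  · refine (hK t ht).trans ?_
    have : 0 ≤ ‖A‖ * K + ‖A‖ * (‖A‖ * K) := by positivity
    linarith
  · refine (h1 t ht).trans (mul_le_mul_of_nonneg_right ?_ ht.1)
    have : 0 ≤ ‖A‖ * (‖A‖ * K) := by positivity
    linarith
  · refine (h2 t ht).trans (mul_le_mul_of_nonneg_right ?_ (sq_nonneg t))
    have : 0 ≤ ‖A‖ * K := by positivity
    linarith

/-- Intertwining of linear vector fields passes to their flows. -/
theorem linearFlow_intertwine {F : Type*} [NormedAddCommGroup F] [NormedSpace ℝ F]
    [CompleteSpace F] {A : E →L[ℝ] E} {B : F →L[ℝ] F} (P : E →L[ℝ] F)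
    (h : ∀ x, P (A x) = B (P x)) (t : ℝ) (x : E) :
    P (linearFlow A t x) = linearFlow B t (P x) := by
  -- The relation passes to powers, hence to the exponential series term by term.
  have hpow : ∀ (n : ℕ) (y : E), P (((t • A) ^ n) y) = ((t • B) ^ n) (P y) := by
    intro n
    induction n with
    | zero => simp
    | succ k ih =>
      intro y
      rw [pow_succ, pow_succ, mul_apply_eq_comp, mul_apply_eq_comp, ih]
      simp [h]
  have hA := NormedSpace.exp_series_hasSum_exp' (𝕂 := ℝ) (t • A)
  have hB := NormedSpace.exp_series_hasSum_exp' (𝕂 := ℝ) (t • B)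
  have hA' := P.hasSum ((ContinuousLinearMap.apply ℝ E x).hasSum hA)
  have hB' := (ContinuousLinearMap.apply ℝ F (P x)).hasSum hB
  refine hA'.unique ?_
  convert hB' using 1
  · funext n
    change P (((n.factorial : ℝ)⁻¹ • (t • A) ^ n) x) = ((n.factorial : ℝ)⁻¹ • (t • B) ^ n) (P x)
    rw [smul_apply, smul_apply, map_smul, hpow]
  · rfl

/-- Measurable controls with values in `C`. -/
def controls (C : Set E) : Set (ℝ → E) := {b | StronglyMeasurable b ∧ ∀ r, b r ∈ C}

theorem controls_const {C : Set E} {c : E} (hc : c ∈ C) : (fun _ => c) ∈ controls C :=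
  ⟨stronglyMeasurable_const, fun _ => hc⟩

theorem controls_shift {C : Set E} {b : ℝ → E} (hb : b ∈ controls C) (t : ℝ) :
    (fun r => b (r + t)) ∈ controls C :=
  ⟨hb.1.comp_measurable (measurable_id.add_const t), fun r => hb.2 (r + t)⟩

theorem controls_concat {C : Set E} {b b' : ℝ → E} (hb : b ∈ controls C) (hb' : b' ∈ controls C)
    (t : ℝ) : (fun r => if r < t then b r else b' (r - t)) ∈ controls C := by
  refine ⟨StronglyMeasurable.ite measurableSet_Iio hb.1
    (hb'.1.comp_measurable (measurable_id.sub_const t)), fun r => ?_⟩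
  dsimp only
  split_ifs
  exacts [hb.2 r, hb'.2 _]

/-- The solution at time `t` of `ẋ = A x + b`, `x 0 = x`. -/
def trajectory (A : E →L[ℝ] E) (b : ℝ → E) (x : E) (t : ℝ) : E :=
  linearFlow A t x + ∫ r in (0 : ℝ)..t, linearFlow A (t - r) (b r)

theorem trajectory_zero (A : E →L[ℝ] E) (b : ℝ → E) (x : E) : trajectory A b x 0 = x := by
  simp [trajectory, linearFlow_zero]

theorem trajectory_sub_trajectory (A : E →L[ℝ] E) (b : ℝ → E) (x y : E) (t : ℝ) :
    trajectory A b x t - trajectory A b y t = linearFlow A t (x - y) := by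
  simp [trajectory]

theorem intervalIntegrable_control {C : Set E} {R : ℝ} (hR : ∀ c ∈ C, ‖c‖ ≤ R) {b : ℝ → E}
    (hb : b ∈ controls C) (u v : ℝ) : IntervalIntegrable b volume u v := by
  refine (intervalIntegrable_const (c := R)).mono_fun hb.1.aestronglyMeasurable ?_
  exact Filter.Eventually.of_forall fun r => (hR _ (hb.2 r)).trans (le_abs_self R)

theorem intervalIntegrable_flow_control (A : E →L[ℝ] E) {C : Set E} {R : ℝ}
    (hR : ∀ c ∈ C, ‖c‖ ≤ R) {b : ℝ → E} (hb : b ∈ controls C) (t u v : ℝ) :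
    IntervalIntegrable (fun r => linearFlow A (t - r) (b r)) volume u v := by
  have hc : Continuous fun r => linearFlow A (t - r) :=
    (continuous_linearFlow A).comp (continuous_const.sub continuous_id)
  obtain ⟨K, hK⟩ := (isCompact_uIcc (a := u) (b := v)).exists_bound_of_continuousOn
    hc.continuousOn
  have hm : StronglyMeasurable fun r => linearFlow A (t - r) (b r) :=
    (isBoundedBilinearMap_apply (𝕜 := ℝ) (E := E) (F := E)).continuous.comp_stronglyMeasurable
      (hc.stronglyMeasurable.prodMk hb.1)
  refine (intervalIntegrable_const (c := K * R)).mono_fun hm.aestronglyMeasurable ?_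
  filter_upwards [ae_restrict_mem measurableSet_uIoc] with r hr
  refine ((linearFlow A (t - r)).le_opNorm _).trans (le_trans ?_ (le_abs_self _))
  have h1 := hK r (uIoc_subset_uIcc hr)
  exact mul_le_mul h1 (hR _ (hb.2 r)) (norm_nonneg _) ((norm_nonneg _).trans h1)

/-- The semigroup property on which dynamic programming rests: stop at time `t` and restart with the
shifted control. -/
theorem trajectory_add (A : E →L[ℝ] E) {C : Set E} {R : ℝ} (hR : ∀ c ∈ C, ‖c‖ ≤ R) {b : ℝ → E}
    (hb : b ∈ controls C) (x : E) (t s : ℝ) :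
    trajectory A b x (t + s) = trajectory A (fun r => b (r + t)) (trajectory A b x t) s := by
  unfold trajectory
  rw [map_add, ← intervalIntegral.integral_add_adjacent_intervals
    (intervalIntegrable_flow_control A hR hb (t + s) 0 t)
    (intervalIntegrable_flow_control A hR hb (t + s) t (t + s)), add_comm t s, linearFlow_add,
    mul_apply_eq_comp, add_assoc]
  congr 2
  · rw [← ContinuousLinearMap.intervalIntegral_comp_comm _
      (intervalIntegrable_flow_control A hR hb t 0 t)]
    congr 1
    funext r
    rw [← mul_apply_eq_comp, ← linearFlow_add, add_sub_assoc]
  · have := intervalIntegral.integral_comp_add_right (a := 0) (b := s)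
      (fun r => linearFlow A (s + t - r) (b r)) t
    rw [zero_add] at this
    rw [← this]
    congr 1
    funext r
    rw [add_sub_add_right_eq_sub]

/-- Endpoints are null, so the value of a concatenated control at the switching time is irrelevant.
-/
theorem trajectory_congr (A : E →L[ℝ] E) {b b' : ℝ → E} {t : ℝ} (ht : 0 ≤ t)
    (h : ∀ r ∈ Ioo 0 t, b r = b' r) (x : E) : trajectory A b x t = trajectory A b' x t := by
  unfold trajectory
  congr 1
  rw [intervalIntegral.integral_of_le ht, intervalIntegral.integral_of_le ht,
    integral_Ioc_eq_integral_Ioo, integral_Ioc_eq_integral_Ioo]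
  exact setIntegral_congr_fun measurableSet_Ioo fun r hr => by simp only [h r hr]

theorem trajectory_intertwine {F : Type*} [NormedAddCommGroup F] [NormedSpace ℝ F]
    [CompleteSpace F] {A : E →L[ℝ] E} {B : F →L[ℝ] F} (P : E →L[ℝ] F)
    (h : ∀ x, P (A x) = B (P x)) {C : Set E} {R : ℝ} (hR : ∀ c ∈ C, ‖c‖ ≤ R) {b : ℝ → E}
    (hb : b ∈ controls C) (x : E) (t : ℝ) :
    P (trajectory A b x t) = trajectory B (fun r => P (b r)) (P x) t := by
  unfold trajectory
  rw [map_add, ← ContinuousLinearMap.intervalIntegral_comp_comm _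
    (intervalIntegrable_flow_control A hR hb t 0 t)]
  simp only [linearFlow_intertwine P h]

/-- One constant serves all controls and starting points. To first order the displacement sees the
control only through its integral. -/
theorem exists_trajectory_bounds (A : E →L[ℝ] E) {C : Set E} {R : ℝ} (hR : ∀ c ∈ C, ‖c‖ ≤ R)
    (T : ℝ) : ∃ K : ℝ, 0 ≤ K ∧ ∀ b ∈ controls C, ∀ t ∈ Icc 0 T, ∀ x,
      ‖trajectory A b x t - x‖ ≤ K * t * (1 + ‖x‖) ∧
      ‖trajectory A b x t - x - (t • A x + ∫ r in (0 : ℝ)..t, b r)‖ ≤ K * t ^ 2 * (1 + ‖x‖) := by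
  obtain ⟨K, hK0, hK⟩ := exists_linearFlow_bounds A T
  rcases C.eq_empty_or_nonempty with rfl | ⟨c, hc⟩
  · exact ⟨0, le_rfl, fun b hb => absurd (hb.2 0) (notMem_empty _)⟩
  have hR0 : 0 ≤ R := (norm_nonneg _).trans (hR c hc)
  refine ⟨K + K * R, by positivity, fun b hb t ht x => ⟨?_, ?_⟩⟩
  · have h1 : ‖∫ r in (0 : ℝ)..t, linearFlow A (t - r) (b r)‖ ≤ K * R * |t - 0| := by
      refine intervalIntegral.norm_integral_le_of_norm_le_const fun r hr => ?_
      rw [uIoc_of_le ht.1] at hr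
      refine ((linearFlow A (t - r)).le_opNorm _).trans ?_
      exact mul_le_mul (hK _ ⟨by linarith [hr.2], by linarith [hr.1, ht.2]⟩).1 (hR _ (hb.2 r))
        (norm_nonneg _) hK0
    rw [sub_zero, abs_of_nonneg ht.1] at h1
    have h2 : ‖linearFlow A t x - x‖ ≤ K * t * ‖x‖ := by
      have := ((linearFlow A t - 1).le_opNorm x).trans
        (mul_le_mul_of_nonneg_right (hK t ht).2.1 (norm_nonneg x))
      simpa using this
    have h3 : trajectory A b x t - x
        = (linearFlow A t x - x) + ∫ r in (0 : ℝ)..t, linearFlow A (t - r) (b r) := by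
      unfold trajectory; abel
    rw [h3]
    refine (norm_add_le _ _).trans ((add_le_add h2 h1).trans ?_)
    have e1 : 0 ≤ K * t := mul_nonneg hK0 ht.1
    have e2 : 0 ≤ K * R * t * ‖x‖ := by have := ht.1; positivity
    nlinarith
  · have h1 : ‖∫ r in (0 : ℝ)..t, (linearFlow A (t - r) - 1) (b r)‖ ≤ K * t * R * |t - 0| := by
      refine intervalIntegral.norm_integral_le_of_norm_le_const fun r hr => ?_
      rw [uIoc_of_le ht.1] at hr
      refine ((linearFlow A (t - r) - 1).le_opNorm _).trans ?_
      have h := (hK (t - r) ⟨by linarith [hr.2], by linarith [hr.1, ht.2]⟩).2.1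
      refine mul_le_mul (h.trans (mul_le_mul_of_nonneg_left (by linarith [hr.1]) hK0))
        (hR _ (hb.2 r)) (norm_nonneg _) (mul_nonneg hK0 ht.1)
    rw [sub_zero, abs_of_nonneg ht.1] at h1
    have h2 : ‖linearFlow A t x - x - t • A x‖ ≤ K * t ^ 2 * ‖x‖ := by
      have := ((linearFlow A t - 1 - t • A).le_opNorm x).trans
        (mul_le_mul_of_nonneg_right (hK t ht).2.2 (norm_nonneg x))
      simpa using this
    have h3 : trajectory A b x t - x - (t • A x + ∫ r in (0 : ℝ)..t, b r)
        = (linearFlow A t x - x - t • A x)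
          + ∫ r in (0 : ℝ)..t, (linearFlow A (t - r) - 1) (b r) := by
      have : ∫ r in (0 : ℝ)..t, (linearFlow A (t - r) - 1) (b r)
          = (∫ r in (0 : ℝ)..t, linearFlow A (t - r) (b r)) - ∫ r in (0 : ℝ)..t, b r := by
        rw [← intervalIntegral.integral_sub (intervalIntegrable_flow_control A hR hb t 0 t)
          (intervalIntegrable_control hR hb 0 t)]
        simp
      rw [this]
      unfold trajectory; abel
    rw [h3]
    refine (norm_add_le _ _).trans ((add_le_add h2 h1).trans ?_)
    have e1 : 0 ≤ K * t ^ 2 := by positivity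
    have e2 : 0 ≤ K * R * t ^ 2 * ‖x‖ := by positivity
    nlinarith

end Trajectory

/-! ### The value function -/

section Value

set_option linter.unusedSectionVars false

variable {E : Type*} [NormedAddCommGroup E] [NormedSpace ℝ E] [CompleteSpace E]

/-- The least terminal cost `g (x(s))` over the trajectories of `ẋ = A x + b`, `b ∈ C`, that start
at `x`. -/
def valueFunction (A : E →L[ℝ] E) (C : Set E) (g : E → ℝ) (x : E) (s : ℝ) : ℝ :=
  ⨅ b : controls C, g (trajectory A b x s)

theorem exists_trajectory_lipschitz (A : E →L[ℝ] E) {C : Set E} {R : ℝ} (hR : ∀ c ∈ C, ‖c‖ ≤ R)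
    (T : ℝ) : ∃ K : ℝ, 0 ≤ K ∧ ∀ b ∈ controls C, ∀ s ∈ Icc 0 T, ∀ t ∈ Icc 0 T, ∀ x y,
      ‖trajectory A b x s - trajectory A b y t‖ ≤ K * (‖x - y‖ + |s - t| * (1 + ‖y‖)) := by
  obtain ⟨K, hK0, hK⟩ := exists_trajectory_bounds A hR T
  obtain ⟨L, hL0, hL⟩ := exists_linearFlow_bounds A T
  have hmono : ∀ b ∈ controls C, ∀ s ∈ Icc 0 T, ∀ t ∈ Icc 0 T, s ≤ t → ∀ y,
      ‖trajectory A b y s - trajectory A b y t‖ ≤ K * (1 + K * T) * (|s - t| * (1 + ‖y‖)) := by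
    intro b hb s hs t ht hst y
    have h1 := (hK b hb s hs y).1
    have h2 := (hK _ (controls_shift hb s) (t - s) ⟨by linarith, by linarith [hs.1, ht.2]⟩
      (trajectory A b y s)).1
    -- The motion from time `s` to `t` is a trajectory restarted at the point reached at time `s`.
    rw [← trajectory_add A hR hb, add_sub_cancel] at h2
    have h3 : ‖trajectory A b y s‖ ≤ ‖y‖ + K * T * (1 + ‖y‖) := by
      have := norm_le_norm_add_norm_sub' (trajectory A b y s) y
      have h4 : K * s * (1 + ‖y‖) ≤ K * T * (1 + ‖y‖) := by
        have := hs.2; have := hs.1; gcongr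
      linarith
    rw [norm_sub_rev, abs_sub_comm, abs_of_nonneg (by linarith)]
    refine h2.trans ?_
    have h5 : 1 + ‖trajectory A b y s‖ ≤ (1 + K * T) * (1 + ‖y‖) := by linarith
    calc K * (t - s) * (1 + ‖trajectory A b y s‖)
        ≤ K * (t - s) * ((1 + K * T) * (1 + ‖y‖)) :=
          mul_le_mul_of_nonneg_left h5 (mul_nonneg hK0 (by linarith))
      _ = _ := by ring
  by_cases hT : 0 ≤ T
  swap
  · exact ⟨0, le_rfl, fun b _ s hs => absurd (hs.1.trans hs.2) hT⟩
  refine ⟨L + K * (1 + K * T), by positivity, fun b hb s hs t ht x y => ?_⟩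
  have h1 : ‖trajectory A b x s - trajectory A b y s‖ ≤ L * ‖x - y‖ := by
    rw [trajectory_sub_trajectory]
    exact ((linearFlow A s).le_opNorm _).trans
      (mul_le_mul_of_nonneg_right (hL s hs).1 (norm_nonneg _))
  have h2 : ‖trajectory A b y s - trajectory A b y t‖
      ≤ K * (1 + K * T) * (|s - t| * (1 + ‖y‖)) := by
    rcases le_total s t with h | h
    · exact hmono b hb s hs t ht h y
    · rw [norm_sub_rev, abs_sub_comm]
      exact hmono b hb t ht s hs h y
  have h3 := norm_sub_le_norm_sub_add_norm_sub (trajectory A b x s) (trajectory A b y s)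
    (trajectory A b y t)
  have e1 : 0 ≤ L * (|s - t| * (1 + ‖y‖)) := by positivity
  have e2 : 0 ≤ K * (1 + K * T) * ‖x - y‖ := by positivity
  linarith

variable [ProperSpace E] {A : E →L[ℝ] E} {C : Set E} {R : ℝ} {g : E → ℝ}

/-- The reachable points lie in a compact ball. Without a lower bound the real infimum would take
its default value. -/
theorem bddBelow_cost (hR : ∀ c ∈ C, ‖c‖ ≤ R) (hg : Continuous g) (x : E) {s : ℝ} (hs : 0 ≤ s) :
    BddBelow (range fun b : controls C => g (trajectory A b x s)) := by
  obtain ⟨K, hK0, hK⟩ := exists_trajectory_bounds A hR s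
  obtain ⟨m, hm⟩ := ((isCompact_closedBall x (K * s * (1 + ‖x‖))).image hg).bddBelow
  refine ⟨m, ?_⟩
  rintro _ ⟨b, rfl⟩
  refine hm ⟨_, ?_, rfl⟩
  rw [mem_closedBall_iff_norm]
  exact (hK b b.2 s ⟨hs, le_rfl⟩ x).1

theorem valueFunction_le (hR : ∀ c ∈ C, ‖c‖ ≤ R) (hg : Continuous g) (x : E) {s : ℝ} (hs : 0 ≤ s)
    {b : ℝ → E} (hb : b ∈ controls C) : valueFunction A C g x s ≤ g (trajectory A b x s) :=
  ciInf_le (bddBelow_cost hR hg x hs) (⟨b, hb⟩ : controls C)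

theorem le_valueFunction (hC : C.Nonempty) {x : E} {s a : ℝ}
    (h : ∀ b ∈ controls C, a ≤ g (trajectory A b x s)) : a ≤ valueFunction A C g x s := by
  obtain ⟨c, hc⟩ := hC
  have : Nonempty (controls C) := ⟨⟨_, controls_const hc⟩⟩
  exact le_ciInf fun b => h b b.2

theorem exists_cost_lt (hC : C.Nonempty) {x : E} {s ε : ℝ} (hε : 0 < ε) :
    ∃ b ∈ controls C, g (trajectory A b x s) < valueFunction A C g x s + ε := by
  obtain ⟨c, hc⟩ := hC
  have : Nonempty (controls C) := ⟨⟨_, controls_const hc⟩⟩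
  obtain ⟨b, hb⟩ := exists_lt_of_ciInf_lt (lt_add_of_pos_right (valueFunction A C g x s) hε)
  exact ⟨b, b.2, hb⟩

theorem valueFunction_zero (hC : C.Nonempty) (x : E) : valueFunction A C g x 0 = g x := by
  obtain ⟨c, hc⟩ := hC
  have : Nonempty (controls C) := ⟨⟨_, controls_const hc⟩⟩
  simp [valueFunction, trajectory_zero]

/-- First half of the dynamic programming principle: any control up to time `t` can be followed by
any other. -/
theorem valueFunction_add_le (hR : ∀ c ∈ C, ‖c‖ ≤ R) (hg : Continuous g) (hC : C.Nonempty) (x : E)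
    {t s : ℝ} (ht : 0 ≤ t) (hs : 0 ≤ s) {b : ℝ → E} (hb : b ∈ controls C) :
    valueFunction A C g x (t + s) ≤ valueFunction A C g (trajectory A b x t) s := by
  refine le_valueFunction hC fun b' hb' => ?_
  have hc := controls_concat hb hb' t
  refine (valueFunction_le hR hg x (add_nonneg ht hs) hc).trans_eq ?_
  rw [trajectory_add A hR hc, trajectory_congr A ht (b' := b), trajectory_congr A hs (b' := b')]
  · intro r hr
    simp [not_lt.2 hr.1.le]
  · intro r hr
    simp [hr.2]

/-- Second half of the dynamic programming principle: the tail of an almost optimal control competes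
in the remaining problem. -/
theorem exists_valueFunction_lt (hR : ∀ c ∈ C, ‖c‖ ≤ R) (hg : Continuous g) (hC : C.Nonempty)
    (x : E) {t s ε : ℝ} (hs : 0 ≤ s) (hε : 0 < ε) :
    ∃ b ∈ controls C,
      valueFunction A C g (trajectory A b x t) s < valueFunction A C g x (t + s) + ε := by
  obtain ⟨b, hb, h⟩ := exists_cost_lt (A := A) (g := g) hC (x := x) (s := t + s) hε
  refine ⟨b, hb, (valueFunction_le hR hg _ hs (controls_shift hb t)).trans_lt ?_⟩
  rwa [← trajectory_add A hR hb]

theorem continuousOn_valueFunction (hR : ∀ c ∈ C, ‖c‖ ≤ R) (hg : Continuous g) (hC : C.Nonempty)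
    (T : ℝ) :
    ContinuousOn (fun z : E × ℝ => valueFunction A C g z.1 z.2) (univ ×ˢ Icc 0 T) := by
  rintro ⟨x, s⟩ ⟨-, hs⟩
  rw [Metric.continuousWithinAt_iff]
  intro ε hε
  obtain ⟨L, hL0, hL⟩ := exists_trajectory_lipschitz A hR T
  obtain ⟨K, hK0, hK⟩ := exists_trajectory_bounds A hR T
  -- The first summand bounds the displacement of trajectories from `x`, the second their distance
  -- to trajectories from points within `1` of `x`. All endpoints thus lie in one compact ball,
  -- where `g` is uniformly continuous.
  set M := K * T * (1 + ‖x‖) + L * (1 + T * (1 + ‖x‖)) with hM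
  have hT : 0 ≤ T := hs.1.trans hs.2
  obtain ⟨δ, hδ, huc⟩ := Metric.uniformContinuousOn_iff.1
    ((isCompact_closedBall x M).uniformContinuousOn_of_continuous hg.continuousOn) (ε / 2)
    (by linarith)
  have hLp : 0 < L * (2 + ‖x‖) + 1 := by positivity
  refine ⟨min 1 (δ / (L * (2 + ‖x‖) + 1)), by positivity, ?_⟩
  rintro ⟨y, t⟩ ⟨-, ht⟩ hd
  obtain ⟨hd1, hd2⟩ := lt_min_iff.1 hd
  rw [lt_div_iff₀ hLp] at hd2
  have hy : ‖y - x‖ ≤ dist (y, t) (x, s) := by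
    rw [← dist_eq_norm]; exact le_max_left _ _
  have hts : |t - s| ≤ dist (y, t) (x, s) := by
    rw [← Real.dist_eq]; exact le_max_right _ _
  have hclose : ∀ b ∈ controls C,
      dist (g (trajectory A b y t)) (g (trajectory A b x s)) < ε / 2 := by
    intro b hb
    have h0 := hL b hb t ht s hs y x
    have hx := (hK b hb s hs x).1
    have hxT : K * s * (1 + ‖x‖) ≤ K * T * (1 + ‖x‖) := by
      have := hs.2; have := hs.1; gcongr
    refine huc _ ?_ _ ?_ ?_
    · rw [mem_closedBall_iff_norm]
      have h2 : |t - s| ≤ T := abs_le.2 ⟨by linarith [ht.1, hs.2], by linarith [ht.2, hs.1]⟩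
      have h1 : L * (‖y - x‖ + |t - s| * (1 + ‖x‖)) ≤ L * (1 + T * (1 + ‖x‖)) := by
        have : ‖y - x‖ ≤ 1 := by linarith
        gcongr
      have := norm_sub_le_norm_sub_add_norm_sub (trajectory A b y t) (trajectory A b x s) x
      linarith
    · rw [mem_closedBall_iff_norm]
      have : 0 ≤ L * (1 + T * (1 + ‖x‖)) := by positivity
      linarith
    · rw [dist_eq_norm]
      refine h0.trans_lt (lt_of_le_of_lt ?_ hd2)
      calc L * (‖y - x‖ + |t - s| * (1 + ‖x‖))
          ≤ L * (dist (y, t) (x, s) + dist (y, t) (x, s) * (1 + ‖x‖)) := by gcongr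
        _ ≤ dist (y, t) (x, s) * (L * (2 + ‖x‖) + 1) := by
          have := dist_nonneg (x := (y, t)) (y := (x, s)); linarith
  have h1 : valueFunction A C g y t - ε / 2 ≤ valueFunction A C g x s :=
    le_valueFunction hC fun b hb => by
      have := valueFunction_le (A := A) hR hg y ht.1 hb
      have := abs_lt.1 (hclose b hb)
      linarith
  have h2 : valueFunction A C g x s - ε / 2 ≤ valueFunction A C g y t :=
    le_valueFunction hC fun b hb => by
      have := valueFunction_le (A := A) hR hg x hs.1 hb
      have := abs_lt.1 (hclose b hb)
      linarith
  rw [Real.dist_eq, abs_lt]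
  constructor <;> linarith

/-- The threshold for `t` is uniform in the control, because the almost optimal control used later
depends on `t`. -/
theorem eventually_trajectory_mem (hR : ∀ c ∈ C, ‖c‖ ≤ R) {x : E} {s : ℝ} {U : Set (E × ℝ)}
    (hU : U ∈ 𝓝 (x, s)) :
    ∀ᶠ t in 𝓝[>] (0 : ℝ), ∀ b ∈ controls C, (trajectory A b x t, s - t) ∈ U := by
  obtain ⟨η, hη, hball⟩ := Metric.mem_nhds_iff.1 hU
  obtain ⟨K, hK0, hK⟩ := exists_trajectory_bounds A hR 1
  have hK1 : 0 < K * (1 + ‖x‖) + 1 := by positivity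
  filter_upwards [Ioo_mem_nhdsGT (show (0 : ℝ) < min 1 (η / (K * (1 + ‖x‖) + 1)) by positivity)]
    with t ht b hb
  obtain ⟨h1, h2⟩ := lt_min_iff.1 ht.2
  rw [lt_div_iff₀ hK1] at h2
  have h3 : 0 ≤ K * t * (1 + ‖x‖) := by have := ht.1; positivity
  apply hball
  rw [Metric.mem_ball, Prod.dist_eq, max_lt_iff]
  constructor
  · rw [dist_eq_norm]
    refine (hK b hb t ⟨ht.1.le, h1.le⟩ x).1.trans_lt ?_
    linarith [ht.1]
  · rw [Real.dist_eq, sub_sub_cancel_left, abs_neg, abs_of_pos ht.1]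
    linarith

/-- First order expansion of a differentiable function along trajectories, uniform in the
control. -/
theorem eventually_trajectory_expansion (hR : ∀ c ∈ C, ‖c‖ ≤ R) {x : E} {s : ℝ} {Ψ : E × ℝ → ℝ}
    {D : E × ℝ →L[ℝ] ℝ} (hΨ : HasFDerivAt Ψ D (x, s)) {ε : ℝ} (hε : 0 < ε) :
    ∀ᶠ t in 𝓝[>] (0 : ℝ), ∀ b ∈ controls C,
      |Ψ (trajectory A b x t, s - t) - Ψ (x, s) - D (t • A x + ∫ r in (0 : ℝ)..t, b r, -t)|
        ≤ ε * t := by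
  obtain ⟨K, hK0, hK⟩ := exists_trajectory_bounds A hR 1
  have hK1 : 0 < K * (1 + ‖x‖) + 1 := by positivity
  have hD1 : 0 < ‖D‖ * K * (1 + ‖x‖) + 1 := by positivity
  have hlo := hΨ.isLittleO.def (show 0 < ε / 2 / (K * (1 + ‖x‖) + 1) by positivity)
  filter_upwards [eventually_trajectory_mem (A := A) hR hlo,
    Ioo_mem_nhdsGT (show (0 : ℝ) < min 1 (ε / 2 / (‖D‖ * K * (1 + ‖x‖) + 1)) by positivity)]
    with t ht1 ht b hb
  obtain ⟨h1, h2⟩ := lt_min_iff.1 ht.2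
  rw [lt_div_iff₀ hD1] at h2
  have ht0 := ht.1
  obtain ⟨hb1, hb2⟩ := hK b hb t ⟨ht.1.le, h1.le⟩ x
  have h3 : ‖Ψ (trajectory A b x t, s - t) - Ψ (x, s) - D (trajectory A b x t - x, -t)‖
      ≤ ε / 2 * t := by
    have h4 := ht1 b hb
    simp only [Prod.mk_sub_mk, sub_sub_cancel_left] at h4
    refine h4.trans ?_
    have h5 : ‖(trajectory A b x t - x, -t)‖ ≤ (K * (1 + ‖x‖) + 1) * t := by
      rw [Prod.norm_def, max_le_iff]
      have : 0 ≤ K * t * (1 + ‖x‖) := by positivity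
      constructor
      · dsimp only; linarith
      · rw [Real.norm_eq_abs, abs_neg, abs_of_pos ht.1]; linarith
    calc _ ≤ ε / 2 / (K * (1 + ‖x‖) + 1) * ((K * (1 + ‖x‖) + 1) * t) := by gcongr
      _ = ε / 2 * t := by field_simp
  have h6 : ‖D (trajectory A b x t - x, -t) - D (t • A x + ∫ r in (0 : ℝ)..t, b r, -t)‖
      ≤ ε / 2 * t := by
    rw [← map_sub, Prod.mk_sub_mk, sub_self]
    refine (D.le_opNorm _).trans ?_
    rw [Prod.norm_mk, norm_zero, max_eq_left (norm_nonneg _)]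
    calc _ ≤ ‖D‖ * (K * t ^ 2 * (1 + ‖x‖)) := by gcongr
      _ = t * (‖D‖ * K * (1 + ‖x‖)) * t := by ring
      _ ≤ ε / 2 * t := by gcongr; linarith
  rw [Real.norm_eq_abs] at h3 h6
  rw [abs_le] at *
  constructor <;> linarith [h3.1, h3.2, h6.1, h6.2]

end Value

/-! ### The value function is a viscosity solution -/

section ValueViscosity

set_option linter.unusedSectionVars false

variable {E : Type*} [NormedAddCommGroup E] [InnerProductSpace ℝ E] [CompleteSpace E]

/-- `H` is the Hamiltonian `sup_{c ∈ C} ⟨-(A x + c), p⟩` of the system `ẋ = A x + c` with controls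
in the nonempty bounded set `C`. -/
structure IsControlHamiltonian (A : E →L[ℝ] E) (C : Set E) (H : ℝ → E → E → ℝ) : Prop where
  nonempty : C.Nonempty
  bounded : ∃ R, ∀ c ∈ C, ‖c‖ ≤ R
  isLUB : ∀ s x p, IsLUB ((fun c => -⟪A x + c, p⟫_ℝ) '' C) (H s x p)

theorem apply_prod_real (D : E × ℝ →L[ℝ] ℝ) (v : E) (r : ℝ) :
    D (v, r) = D (v, 0) + r * D (0, 1) := by
  rw [← smul_eq_mul, ← map_smul, ← map_add]
  simp

theorem deriv_and_gradient_of_hasFDerivAt {ψ : E → ℝ → ℝ} {x : E} {s : ℝ} {D : E × ℝ →L[ℝ] ℝ}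
    (h : HasFDerivAt (fun z : E × ℝ => ψ z.1 z.2) D (x, s)) :
    deriv (fun r => ψ x r) s = D (0, 1) ∧
      ∀ v, ⟪v, gradient (fun y => ψ y s) x⟫_ℝ = D (v, 0) := by
  constructor
  · have h1 : HasDerivAt (fun r : ℝ => ((x, r) : E × ℝ)) (0, 1) s :=
      (hasDerivAt_const s x).prodMk (hasDerivAt_id s)
    exact (h.comp_hasDerivAt s h1).deriv
  · intro v
    have h1 : HasFDerivAt (fun y : E => ((y, s) : E × ℝ)) (ContinuousLinearMap.inl ℝ E ℝ) x :=
      hasFDerivAt_prodMk_left x s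
    have h2 : HasFDerivAt (fun y => ψ y s) (D.comp (ContinuousLinearMap.inl ℝ E ℝ)) x :=
      HasFDerivAt.comp (g := fun z : E × ℝ => ψ z.1 z.2) x h h1
    rw [real_inner_comm, gradient, InnerProductSpace.toDual_symm_apply, h2.fderiv]
    simp

variable [ProperSpace E] {A : E →L[ℝ] E} {C : Set E} {g : E → ℝ} {H : ℝ → E → E → ℝ}

/-- A constant control `c` cannot beat the value. Expanding the test function along its trajectory
and dividing by `t` gives the inequality for each `c`, hence for the supremum. -/
theorem IsControlHamiltonian.isViscositySubsolution_valueFunction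
    (hH : IsControlHamiltonian A C H) (hg : Continuous g) (T : ℝ) :
    IsViscositySubsolution T H (valueFunction A C g) := by
  obtain ⟨R, hR⟩ := hH.bounded
  intro ψ hψ x s hs hmax
  have hD := (hψ.differentiable one_ne_zero (x, s)).hasFDerivAt
  set D := fderiv ℝ (fun z : E × ℝ => ψ z.1 z.2) (x, s)
  obtain ⟨h1, h2⟩ := deriv_and_gradient_of_hasFDerivAt hD
  set p := gradient (fun y => ψ y s) x
  suffices H s x p ≤ -D (0, 1) by rw [h1]; linarith
  refine (hH.isLUB s x p).2 ?_
  rintro _ ⟨c, hc, rfl⟩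
  dsimp only
  refine le_of_forall_pos_le_add fun ε hε => ?_
  obtain ⟨t, ht1, ht2, ht3⟩ := ((eventually_trajectory_expansion (A := A) hR hD hε).and
    ((eventually_trajectory_mem (A := A) hR hmax).and (Ioo_mem_nhdsGT hs.1))).exists
  have hb := controls_const hc
  have e1 := ht1 _ hb
  have e2 := ht2 _ hb
  have e3 := valueFunction_add_le (A := A) hR hg hH.nonempty x ht3.1.le
    (sub_nonneg.2 ht3.2.le) hb
  rw [add_sub_cancel] at e3
  simp only [mem_ofPred_eq] at e2
  have e4 : D (t • A x + ∫ _ in (0 : ℝ)..t, c, -t) = t * (⟪A x + c, p⟫_ℝ - D (0, 1)) := by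
    rw [apply_prod_real, ← h2, intervalIntegral.integral_const, sub_zero, ← smul_add,
      real_inner_smul_left]
    ring
  rw [e4, abs_le] at e1
  have := e1.1
  have : t * (-⟪A x + c, p⟫_ℝ) ≤ t * (-D (0, 1) + ε) := by linarith
  exact le_of_mul_le_mul_left this ht3.1

/-- A control optimal up to `ε / 2 * t` loses only `ε / 2` after division by `t`. It need not be
continuous; only its mean enters, and `H` bounds the integrand pointwise. -/
theorem IsControlHamiltonian.isViscositySupersolution_valueFunction
    (hH : IsControlHamiltonian A C H) (hg : Continuous g) (T : ℝ) :
    IsViscositySupersolution T H (valueFunction A C g) := by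
  obtain ⟨R, hR⟩ := hH.bounded
  intro ψ hψ x s hs hmin
  have hD := (hψ.differentiable one_ne_zero (x, s)).hasFDerivAt
  set D := fderiv ℝ (fun z : E × ℝ => ψ z.1 z.2) (x, s)
  obtain ⟨h1, h2⟩ := deriv_and_gradient_of_hasFDerivAt hD
  set p := gradient (fun y => ψ y s) x
  rw [h1]
  refine le_of_forall_pos_le_add fun ε hε => ?_
  obtain ⟨t, ht1, ht2, ht3⟩ := ((eventually_trajectory_expansion (A := A) hR hD (half_pos hε)).and
    ((eventually_trajectory_mem (A := A) hR hmin).and (Ioo_mem_nhdsGT hs.1))).exists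
  have ht0 := ht3.1
  obtain ⟨b, hb, e3⟩ := exists_valueFunction_lt (A := A) (t := t) hR hg hH.nonempty x
    (sub_nonneg.2 ht3.2.le) (show 0 < ε / 2 * t by positivity)
  have e1 := ht1 _ hb
  have e2 := ht2 _ hb
  rw [add_sub_cancel] at e3
  simp only [mem_ofPred_eq] at e2
  have hbi := intervalIntegrable_control hR hb 0 t
  have e5 : -(t * H s x p) ≤ ⟪t • A x + ∫ r in (0 : ℝ)..t, b r, p⟫_ℝ := by
    have e6 : ∫ _ in (0 : ℝ)..t, (-H s x p - ⟪A x, p⟫_ℝ) ≤ ∫ r in (0 : ℝ)..t, ⟪p, b r⟫_ℝ := by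
      refine intervalIntegral.integral_mono ht0.le intervalIntegrable_const
        ⟨hbi.1.const_inner p, hbi.2.const_inner p⟩ fun r => ?_
      have := (hH.isLUB s x p).1 ⟨b r, hb.2 r, rfl⟩
      simp only [inner_add_left] at this
      rw [real_inner_comm (b r) p]
      linarith
    have e7 : ∫ r in (0 : ℝ)..t, ⟪p, b r⟫_ℝ = ⟪p, ∫ r in (0 : ℝ)..t, b r⟫_ℝ :=
      ContinuousLinearMap.intervalIntegral_comp_comm (innerSL ℝ p) hbi
    rw [e7, intervalIntegral.integral_const, smul_eq_mul, sub_zero] at e6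
    rw [inner_add_left, real_inner_smul_left, real_inner_comm p (∫ r in (0 : ℝ)..t, b r)]
    linarith
  have e4 : D (t • A x + ∫ r in (0 : ℝ)..t, b r, -t)
      = ⟪t • A x + ∫ r in (0 : ℝ)..t, b r, p⟫_ℝ - t * D (0, 1) := by
    rw [apply_prod_real, ← h2]
    ring
  rw [e4, abs_le] at e1
  have := e1.2
  have : t * 0 ≤ t * (D (0, 1) + H s x p + ε) := by linarith
  exact le_of_mul_le_mul_left this ht0

theorem IsControlHamiltonian.isViscositySolution_valueFunction
    (hH : IsControlHamiltonian A C H) (hg : Continuous g) (T : ℝ) :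
    IsViscositySolution T H g (valueFunction A C g) where
  continuousOn := by
    obtain ⟨R, hR⟩ := hH.bounded
    exact continuousOn_valueFunction hR hg hH.nonempty T
  initial := valueFunction_zero hH.nonempty
  subsolution := hH.isViscositySubsolution_valueFunction hg T
  supersolution := hH.isViscositySupersolution_valueFunction hg T

end ValueViscosity

/-! ### Comparison of viscosity sub- and supersolutions -/

section Comparison

variable {E : Type*} [NormedAddCommGroup E] [InnerProductSpace ℝ E]

/-- A `C¹` barrier that is small at `(x₀, s₀)`, large on the lateral and terminal boundary of a
cylinder, and increases along every field of growth `c (1 + ‖x‖)`. -/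
theorem exists_barrier {c : ℝ} (hc : 0 ≤ c) (x₀ : E) {s₀ S a : ℝ} (hs₀ : 0 ≤ s₀) (hS : s₀ < S)
    (ha : 0 < a) :
    ∃ R : ℝ, ‖x₀‖ ≤ R ∧ ∀ B : ℝ, ∃ χ : E × ℝ → ℝ, ContDiff ℝ 1 χ ∧ (∀ z, 0 ≤ χ z) ∧
      χ (x₀, s₀) = a ∧
      (∀ x s, 0 ≤ s → (R ≤ ‖x‖ ∨ S ≤ s) → B ≤ χ (x, s)) ∧
      ∀ z, ∃ N : ℝ, 0 ≤ N ∧ (∀ v, fderiv ℝ χ z (v, 0) ≤ N * ‖v‖) ∧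
        c * (1 + ‖z.1‖) * N ≤ fderiv ℝ χ z (0, 1) := by
  set b : ℝ := 1 + ‖x₀‖ ^ 2 with hb
  have hb1 : 1 ≤ b := by rw [hb]; nlinarith [sq_nonneg ‖x₀‖]
  have hb0 : 0 < b := by linarith
  have hSs : 0 < S - s₀ := sub_pos.2 hS
  -- The term `4 * c` makes growth in time dominate transport, as `(1 + r) 2r ≤ 4 (1 + r²)`; the
  -- other makes the exponential at least `2 * b` from time `S` on.
  set L : ℝ := 4 * c + 2 * b / (S - s₀) with hL
  have hL0 : 0 ≤ L := by positivity
  have hLc : 4 * c ≤ L := by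
    have : 0 ≤ 2 * b / (S - s₀) := by positivity
    linarith
  have hLS : 2 * b ≤ L * (S - s₀) := by
    have : 2 * b / (S - s₀) * (S - s₀) = 2 * b := by field_simp
    nlinarith [mul_nonneg hc hSs.le]
  -- Large enough for `G ≥ 2` outside the ball, even at time `0`. It precedes `B`, which will bound
  -- functions on the cylinder of radius `R`.
  set R : ℝ := 2 * b * Real.exp (L * s₀) with hR
  have hexp1 : 1 ≤ Real.exp (L * s₀) := Real.one_le_exp (by positivity)
  have hR1 : 2 * b ≤ R := by nlinarith
  refine ⟨R, ?_, fun B => ?_⟩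
  · nlinarith [sq_nonneg (‖x₀‖ - 1)]
  -- Since `G` is `1` at the base point and at least `2` on the boundary, a high power reaches `B`
  -- on the boundary without changing the base value.
  obtain ⟨k, hk⟩ := pow_unbounded_of_one_lt (B / a) (one_lt_two (α := ℝ))
  set G : E × ℝ → ℝ := fun z => (1 + ‖z.1‖ ^ 2) / b * Real.exp (L * (z.2 - s₀)) with hG
  have hGpos : ∀ z, 0 < G z := fun z => by positivity
  have hG2 : ∀ x s, 0 ≤ s → (R ≤ ‖x‖ ∨ S ≤ s) → 2 ≤ G (x, s) := by
    intro x s hs h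
    have hx2 := sq_nonneg ‖x‖
    rcases h with h | h
    · have h1 : R ≤ 1 + ‖x‖ ^ 2 := by nlinarith [sq_nonneg (‖x‖ - 1)]
      have h2 : Real.exp (-(L * s₀)) ≤ Real.exp (L * (s - s₀)) :=
        Real.exp_le_exp.2 (by nlinarith)
      calc (2 : ℝ) = R / b * Real.exp (-(L * s₀)) := by
            rw [hR, Real.exp_neg]; field_simp
        _ ≤ _ := by simp only [hG]; gcongr
    · have h1 : 2 * b ≤ Real.exp (L * (s - s₀)) := by
        have h2 := Real.add_one_le_exp (L * (s - s₀))
        nlinarith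
      calc (2 : ℝ) = 1 / b * (2 * b) := by field_simp
        _ ≤ _ := by
          simp only [hG]
          gcongr
          linarith
  have hGd : ∀ z : E × ℝ, HasFDerivAt G
      (((1 + ‖z.1‖ ^ 2) / b) • (Real.exp (L * (z.2 - s₀)) • (L • ContinuousLinearMap.snd ℝ E ℝ)) +
        Real.exp (L * (z.2 - s₀)) •
          (b⁻¹ • (2 • (innerSL ℝ z.1).comp (ContinuousLinearMap.fst ℝ E ℝ)))) z := by
    intro z
    have h1 : HasFDerivAt (fun z : E × ℝ => ‖z.1‖ ^ 2)
        (2 • (innerSL ℝ z.1).comp (ContinuousLinearMap.fst ℝ E ℝ)) z :=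
      hasFDerivAt_fst.norm_sq
    have h2 : HasFDerivAt (fun z : E × ℝ => L * (z.2 - s₀)) (L • ContinuousLinearMap.snd ℝ E ℝ) z :=
      (hasFDerivAt_snd.sub_const s₀).const_mul L
    have h3 : HasFDerivAt (fun z : E × ℝ => (1 + ‖z.1‖ ^ 2) / b)
        (b⁻¹ • (2 • (innerSL ℝ z.1).comp (ContinuousLinearMap.fst ℝ E ℝ))) z := by
      simp only [div_eq_inv_mul]
      exact (h1.const_add 1).const_mul b⁻¹
    exact h3.mul h2.exp
  have hGc : ContDiff ℝ 1 G := by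
    refine ContDiff.mul ?_ ?_
    · exact (contDiff_const.add (contDiff_fst.norm_sq ℝ)).div_const b
    · exact (contDiff_const.mul (contDiff_snd.sub contDiff_const)).exp
  have hχd : ∀ z : E × ℝ, fderiv ℝ (fun z => a * G z ^ (k + 1)) z =
      (a * ((k + 1 : ℝ) * G z ^ k)) • fderiv ℝ G z := by
    intro z
    have h := (((hGd z).differentiableAt.hasFDerivAt).pow (k + 1)).const_mul a
    rw [h.fderiv, smul_smul]
    simp
  refine ⟨fun z => a * G z ^ (k + 1), contDiff_const.mul (hGc.pow _), fun z => ?_, ?_, ?_, ?_⟩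
  · have := hGpos z; positivity
  · have : G (x₀, s₀) = 1 := by
      simp only [hG, sub_self, mul_zero, Real.exp_zero, mul_one]
      exact div_self hb0.ne'
    simp [this]
  · intro x s hs h
    have h1 : (2 : ℝ) ^ k ≤ G (x, s) ^ (k + 1) :=
      (pow_le_pow_right₀ one_le_two k.le_succ).trans
        (pow_le_pow_left₀ two_pos.le (hG2 x s hs h) _)
    have h2 := (div_lt_iff₀ ha).1 hk
    nlinarith
  · intro z
    have hM : 0 ≤ a * ((k + 1 : ℝ) * G z ^ k) := by have := hGpos z; positivity
    have he := Real.exp_pos (L * (z.2 - s₀))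
    refine ⟨(a * ((k + 1 : ℝ) * G z ^ k)) * (Real.exp (L * (z.2 - s₀)) * (b⁻¹ * (2 * ‖z.1‖))),
      by positivity, fun v => ?_, ?_⟩
    · rw [hχd, (hGd z).fderiv, smul_apply, smul_eq_mul, mul_assoc (a * ((k + 1 : ℝ) * G z ^ k))]
      refine mul_le_mul_of_nonneg_left ?_ hM
      have h1 : ((((1 + ‖z.1‖ ^ 2) / b) • (Real.exp (L * (z.2 - s₀)) •
          (L • ContinuousLinearMap.snd ℝ E ℝ)) + Real.exp (L * (z.2 - s₀)) •
          (b⁻¹ • (2 • (innerSL ℝ z.1).comp (ContinuousLinearMap.fst ℝ E ℝ)))) : E × ℝ →L[ℝ] ℝ)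
          (v, 0) = Real.exp (L * (z.2 - s₀)) * (b⁻¹ * (2 * ⟪z.1, v⟫_ℝ)) := by
        simp
      rw [h1, mul_assoc, mul_assoc, mul_assoc]
      have := real_inner_le_norm z.1 v
      gcongr
    · rw [hχd, (hGd z).fderiv, smul_apply, smul_eq_mul]
      have h1 : ((((1 + ‖z.1‖ ^ 2) / b) • (Real.exp (L * (z.2 - s₀)) •
          (L • ContinuousLinearMap.snd ℝ E ℝ)) + Real.exp (L * (z.2 - s₀)) •
          (b⁻¹ • (2 • (innerSL ℝ z.1).comp (ContinuousLinearMap.fst ℝ E ℝ)))) : E × ℝ →L[ℝ] ℝ)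
          (0, 1) = Real.exp (L * (z.2 - s₀)) * (b⁻¹ * ((1 + ‖z.1‖ ^ 2) * L)) := by
        simp
        ring
      rw [h1, mul_left_comm]
      refine mul_le_mul_of_nonneg_left ?_ hM
      rw [mul_left_comm]
      refine mul_le_mul_of_nonneg_left ?_ he.le
      rw [mul_left_comm]
      refine mul_le_mul_of_nonneg_left ?_ (by positivity)
      have h2 : (1 + ‖z.1‖) * (2 * ‖z.1‖) ≤ (1 + ‖z.1‖ ^ 2) * 4 := by
        nlinarith [sq_nonneg (‖z.1‖ - 1)]
      calc c * (1 + ‖z.1‖) * (2 * ‖z.1‖) = c * ((1 + ‖z.1‖) * (2 * ‖z.1‖)) := by ring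
        _ ≤ c * ((1 + ‖z.1‖ ^ 2) * 4) := mul_le_mul_of_nonneg_left h2 hc
        _ = (1 + ‖z.1‖ ^ 2) * (4 * c) := by ring
        _ ≤ _ := by gcongr

theorem hasFDerivAt_mul_norm_sq_add_sq (k : ℝ) (y : E) (t : ℝ) (z : E × ℝ) :
    HasFDerivAt (fun z : E × ℝ => k * (‖z.1 - y‖ ^ 2 + (z.2 - t) ^ 2))
      (k • (2 • (innerSL ℝ (z.1 - y)).comp (ContinuousLinearMap.fst ℝ E ℝ) +
        (2 * (z.2 - t)) • ContinuousLinearMap.snd ℝ E ℝ)) z := by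
  have h0 : HasFDerivAt (fun z : E × ℝ => z.1 - y) (ContinuousLinearMap.fst ℝ E ℝ) z :=
    hasFDerivAt_fst.sub_const y
  have h1 : HasFDerivAt (fun z : E × ℝ => ‖z.1 - y‖ ^ 2)
      (2 • (innerSL ℝ (z.1 - y)).comp (ContinuousLinearMap.fst ℝ E ℝ)) z := h0.norm_sq
  have h2 : HasFDerivAt (fun z : E × ℝ => z.2 - t) (ContinuousLinearMap.snd ℝ E ℝ) z :=
    hasFDerivAt_snd.sub_const t
  have h3 : HasFDerivAt (fun z : E × ℝ => (z.2 - t) ^ 2)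
      ((2 * (z.2 - t)) • ContinuousLinearMap.snd ℝ E ℝ) z := by
    refine (h2.pow 2).congr_fderiv ?_
    ext <;> simp
  exact (h1.add h3).const_mul k

theorem contDiff_mul_norm_sq_add_sq (k : ℝ) (y : E) (t : ℝ) :
    ContDiff ℝ 1 (fun z : E × ℝ => k * (‖z.1 - y‖ ^ 2 + (z.2 - t) ^ 2)) :=
  contDiff_const.mul (((contDiff_fst.sub contDiff_const).norm_sq ℝ).add
    ((contDiff_snd.sub contDiff_const).pow 2))

variable [CompleteSpace E] {H : ℝ → E → E → ℝ} {c κ T : ℝ} {u v : E → ℝ → ℝ}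

/-- The viscosity inequalities at a maximum point of the doubled function. -/
theorem slope_le_of_doubled_isLocalMax
    (hHp : ∀ s x p q, H s x p ≤ H s x q + c * (1 + ‖x‖) * ‖p - q‖)
    (hHx : ∀ s t x y p, H s x p ≤ H t y p + κ * ‖x - y‖ * ‖p‖)
    (hu : IsViscositySubsolution T H u) (hv : IsViscositySupersolution T H v)
    (hc : 0 ≤ c) {χ : E × ℝ → ℝ} (hχ : ContDiff ℝ 1 χ) {l k : ℝ} (hk : 0 ≤ k) {z w : E × ℝ}
    (hχN : ∃ N : ℝ, 0 ≤ N ∧ (∀ v, fderiv ℝ χ z (v, 0) ≤ N * ‖v‖) ∧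
        c * (1 + ‖z.1‖) * N ≤ fderiv ℝ χ z (0, 1))
    (hz : z.2 ∈ Ioo 0 T) (hw : w.2 ∈ Ioo 0 T)
    (hmaxz : IsLocalMax (fun z : E × ℝ => u z.1 z.2 - v w.1 w.2
      - k * (‖z.1 - w.1‖ ^ 2 + (z.2 - w.2) ^ 2) - χ z - l * z.2) z)
    (hmaxw : IsLocalMax (fun w : E × ℝ => u z.1 z.2 - v w.1 w.2
      - k * (‖z.1 - w.1‖ ^ 2 + (z.2 - w.2) ^ 2) - χ z - l * z.2) w) :
    l ≤ κ * (2 * (k * ‖z.1 - w.1‖ ^ 2)) := by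
  obtain ⟨x, s⟩ := z
  obtain ⟨y, t⟩ := w
  obtain ⟨N, hN0, hN1, hN2⟩ := hχN
  dsimp only at *
  have hc1 : ContDiff ℝ 1 fun z : E × ℝ =>
      k * (‖z.1 - y‖ ^ 2 + (z.2 - t) ^ 2) + χ z + l * z.2 :=
    ((contDiff_mul_norm_sq_add_sq k y t).add hχ).add (contDiff_const.mul contDiff_snd)
  have hd1 : HasFDerivAt (fun z : E × ℝ =>
      k * (‖z.1 - y‖ ^ 2 + (z.2 - t) ^ 2) + χ z + l * z.2)
      (k • (2 • (innerSL ℝ (x - y)).comp (ContinuousLinearMap.fst ℝ E ℝ) +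
        (2 * (s - t)) • ContinuousLinearMap.snd ℝ E ℝ) + fderiv ℝ χ (x, s) +
        l • ContinuousLinearMap.snd ℝ E ℝ) (x, s) :=
    ((hasFDerivAt_mul_norm_sq_add_sq k y t (x, s)).add
      (hχ.differentiable one_ne_zero _).hasFDerivAt).add (hasFDerivAt_snd.const_mul l)
  have hc2 := (contDiff_mul_norm_sq_add_sq k x s).neg
  have hd2 := (hasFDerivAt_mul_norm_sq_add_sq k x s (y, t)).neg
  have hsub := hu (fun x s => k * (‖x - y‖ ^ 2 + (s - t) ^ 2) + χ (x, s) + l * s) hc1 x s hz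
    (by
      filter_upwards [hmaxz] with z hz
      linarith)
  have hsup := hv (fun y t => -(k * (‖y - x‖ ^ 2 + (t - s) ^ 2))) hc2 y t hw
    (by
      filter_upwards [hmaxw] with z hz
      rw [norm_sub_rev z.1 x, norm_sub_rev y x, sub_sq_comm z.2 s, sub_sq_comm t s]
      linarith)
  obtain ⟨e1, e2⟩ := deriv_and_gradient_of_hasFDerivAt
    (ψ := fun x s => k * (‖x - y‖ ^ 2 + (s - t) ^ 2) + χ (x, s) + l * s) hd1
  obtain ⟨e3, e4⟩ := deriv_and_gradient_of_hasFDerivAt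
    (ψ := fun y t => -(k * (‖y - x‖ ^ 2 + (t - s) ^ 2))) hd2
  rw [e1] at hsub
  rw [e3] at hsup
  set p := gradient (fun x => k * (‖x - y‖ ^ 2 + (s - t) ^ 2) + χ (x, s) + l * s) x
  set q := gradient (fun y => -(k * (‖y - x‖ ^ 2 + (t - s) ^ 2))) y
  have hq : q = (2 * k) • (x - y) := by
    refine ext_inner_left ℝ fun v => ?_
    rw [e4, inner_smul_right, real_inner_comm]
    simp [inner_sub_left]
    ring
  -- The penalty contributes the same gradient to `p` and `q`, so `p - q` is the spatial gradient of
  -- `χ`; it is tested against itself.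
  have hpq : ‖q - p‖ ≤ N := by
    have h1 : ⟪p - q, p - q⟫_ℝ ≤ N * ‖p - q‖ := by
      refine le_trans (le_of_eq ?_) (hN1 (p - q))
      rw [inner_sub_right, e2, hq, inner_smul_right, real_inner_comm (x - y)]
      simp [inner_sub_left]
      ring
    rw [real_inner_self_eq_norm_mul_norm] at h1
    rw [norm_sub_rev]
    rcases (norm_nonneg (p - q)).eq_or_lt with h0 | h0
    · rwa [← h0]
    · exact le_of_mul_le_mul_right h1 h0
  have h1 := hHx t s y x q
  have h2 := hHp s x q p
  have h3 : c * (1 + ‖x‖) * ‖q - p‖ ≤ fderiv ℝ χ (x, s) (0, 1) :=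
    le_trans (mul_le_mul_of_nonneg_left hpq (by positivity)) hN2
  have h4 : κ * ‖y - x‖ * ‖q‖ = κ * (2 * (k * ‖x - y‖ ^ 2)) := by
    rw [hq, norm_smul, norm_sub_rev y x, Real.norm_eq_abs, abs_of_nonneg (by positivity)]
    ring
  -- Both time derivatives contain `2 k (s - t)`, which cancels on subtraction.
  simp at hsub hsup
  linarith

end Comparison

/-! ### Comparison by doubling of variables, and uniqueness. -/

section Uniqueness

variable {E : Type*} [NormedAddCommGroup E] [InnerProductSpace ℝ E] [CompleteSpace E]
  [ProperSpace E] {H : ℝ → E → E → ℝ} {c κ T : ℝ} {u v : E → ℝ → ℝ}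

theorem comparison_of_mem_Ioo (hc : 0 ≤ c)
    (hHp : ∀ s x p q, H s x p ≤ H s x q + c * (1 + ‖x‖) * ‖p - q‖)
    (hHx : ∀ s t x y p, H s x p ≤ H t y p + κ * ‖x - y‖ * ‖p‖)
    (hu : IsViscositySubsolution T H u) (hv : IsViscositySupersolution T H v)
    (huc : ContinuousOn (fun z : E × ℝ => u z.1 z.2) (univ ×ˢ Icc 0 T))
    (hvc : ContinuousOn (fun z : E × ℝ => v z.1 z.2) (univ ×ˢ Icc 0 T))
    (h0 : ∀ x, u x 0 ≤ v x 0) (x₀ : E) {s₀ : ℝ} (hs₀ : s₀ ∈ Ioo 0 T) : u x₀ s₀ ≤ v x₀ s₀ := by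
  by_contra! hlt
  obtain ⟨m, hm, hmuv⟩ : ∃ m, 0 < m ∧ u x₀ s₀ - v x₀ s₀ = m := ⟨_, sub_pos.2 hlt, rfl⟩
  obtain ⟨S, hS1, hS2⟩ := exists_between hs₀.2
  have hS0 : 0 < S := hs₀.1.trans hS1
  obtain ⟨R, hR, hbar⟩ := exists_barrier hc x₀ hs₀.1.le hS1 (show 0 < m / 4 by positivity)
  set D : Set (E × ℝ) := Metric.closedBall 0 R ×ˢ Icc 0 S with hD
  have hDc : IsCompact D := (isCompact_closedBall 0 R).prod isCompact_Icc
  have hDsub : D ⊆ univ ×ˢ Icc 0 T :=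
    prod_mono (subset_univ _) (Icc_subset_Icc le_rfl hS2.le)
  have hz₀ : (x₀, s₀) ∈ D := ⟨by simpa using hR, hs₀.1.le, hS1.le⟩
  have hucD := huc.mono hDsub
  have hvcD := hvc.mono hDsub
  obtain ⟨Bu, hBu⟩ := hDc.exists_bound_of_continuousOn hucD
  obtain ⟨Bv, hBv⟩ := hDc.exists_bound_of_continuousOn hvcD
  have hB : ∀ z ∈ D, ∀ w ∈ D, u z.1 z.2 - v w.1 w.2 ≤ Bu + Bv := fun z hz w hw => by
    have h1 := (abs_le.1 (hBu z hz)).2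
    have h2 := (abs_le.1 (hBv w hw)).1
    linarith
  obtain ⟨χ, hχ, hχ0, hχz₀, hχB, hχN⟩ := hbar (Bu + Bv)
  -- Of the gap `m` at the base point the barrier uses `m / 4` and the slope `l` at most `m / 2`,
  -- leaving `m / 4`.
  set l : ℝ := m / (2 * S) with hl
  have hl0 : 0 < l := by positivity
  have hls : l * s₀ ≤ m / 2 := by
    rw [hl, div_mul_eq_mul_div, div_le_div_iff₀ (by positivity) two_pos]
    nlinarith [hs₀.1]
  set Φ : ℕ → (E × ℝ) × (E × ℝ) → ℝ := fun n q => u q.1.1 q.1.2 - v q.2.1 q.2.2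
    - (n : ℝ) * (‖q.1.1 - q.2.1‖ ^ 2 + (q.1.2 - q.2.2) ^ 2) - χ q.1 - l * q.1.2 with hΦ
  have hΦc : ∀ n, ContinuousOn (Φ n) (D ×ˢ D) := by
    intro n
    have h1 : ContinuousOn (fun q : (E × ℝ) × (E × ℝ) => u q.1.1 q.1.2) (D ×ˢ D) :=
      hucD.comp continuousOn_fst fun q hq => hq.1
    have h2 : ContinuousOn (fun q : (E × ℝ) × (E × ℝ) => v q.2.1 q.2.2) (D ×ˢ D) :=
      hvcD.comp continuousOn_snd fun q hq => hq.2
    have h3 := hχ.continuous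
    have h4 : Continuous fun q : (E × ℝ) × (E × ℝ) =>
      (n : ℝ) * (‖q.1.1 - q.2.1‖ ^ 2 + (q.1.2 - q.2.2) ^ 2) := by fun_prop
    have h5 : Continuous fun q : (E × ℝ) × (E × ℝ) => χ q.1 := by fun_prop
    have h6 : Continuous fun q : (E × ℝ) × (E × ℝ) => l * q.1.2 := by fun_prop
    exact (((h1.sub h2).sub h4.continuousOn).sub h5.continuousOn).sub h6.continuousOn
  have hmax := fun n => (hDc.prod hDc).exists_isMaxOn ⟨((x₀, s₀), (x₀, s₀)), hz₀, hz₀⟩ (hΦc n)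
  choose q hqD hqmax using hmax
  have hlow : ∀ n, m / 4 ≤ Φ n (q n) := by
    intro n
    refine le_trans ?_ (hqmax n (show ((x₀, s₀), (x₀, s₀)) ∈ D ×ˢ D from ⟨hz₀, hz₀⟩))
    simp only [hΦ, sub_self, norm_zero, hχz₀, hmuv]
    norm_num
    linarith
  obtain ⟨⟨z, w⟩, hzw, φ, hφ, hlim⟩ := (hDc.prod hDc).tendsto_subseq hqD
  have hlz : Filter.Tendsto (fun n => (q (φ n)).1) Filter.atTop (𝓝 z) :=
    (continuous_fst.tendsto _).comp hlim
  have hlw : Filter.Tendsto (fun n => (q (φ n)).2) Filter.atTop (𝓝 w) :=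
    (continuous_snd.tendsto _).comp hlim
  have hφt : Filter.Tendsto (fun n => ((φ n : ℕ) : ℝ)) Filter.atTop Filter.atTop :=
    tendsto_natCast_atTop_atTop.comp hφ.tendsto_atTop
  set d : ℕ → ℝ := fun n =>
    ‖(q n).1.1 - (q n).2.1‖ ^ 2 + ((q n).1.2 - (q n).2.2) ^ 2 with hd
  have hd0 : ∀ n, 0 ≤ d n := fun n => by positivity
  have hnd : ∀ n : ℕ, (n : ℝ) * d n ≤ Bu + Bv := by
    intro n
    have h1 := hlow n
    have h2 := hB _ (hqD n).1 _ (hqD n).2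
    have h3 := hχ0 (q n).1
    have h4 : 0 ≤ l * (q n).1.2 := mul_nonneg hl0.le (hqD n).1.2.1
    simp only [hΦ] at h1
    simp only [hd]
    linarith
  have hdlim : Filter.Tendsto (fun n => d (φ n)) Filter.atTop (𝓝 0) := by
    have h1 : Filter.Tendsto (fun n => (Bu + Bv) / ((φ n : ℕ) : ℝ)) Filter.atTop (𝓝 0) :=
      hφt.const_div_atTop _
    refine squeeze_zero' (Filter.Eventually.of_forall fun n => hd0 _) ?_ h1
    filter_upwards [hφt.eventually_gt_atTop 0] with n hn
    rw [le_div_iff₀ hn, mul_comm]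
    exact hnd _
  have hzw' : z = w := by
    have h1 : Filter.Tendsto (fun n => d (φ n)) Filter.atTop
        (𝓝 (‖z.1 - w.1‖ ^ 2 + (z.2 - w.2) ^ 2)) := by
      have h2 : Continuous fun p : (E × ℝ) × (E × ℝ) =>
        ‖p.1.1 - p.2.1‖ ^ 2 + (p.1.2 - p.2.2) ^ 2 := by fun_prop
      exact (h2.tendsto (z, w)).comp hlim
    have h3 := tendsto_nhds_unique h1 hdlim
    have h4 : ‖z.1 - w.1‖ ^ 2 = 0 := by nlinarith [sq_nonneg ‖z.1 - w.1‖, sq_nonneg (z.2 - w.2)]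
    have h5 : (z.2 - w.2) ^ 2 = 0 := by nlinarith [sq_nonneg ‖z.1 - w.1‖, sq_nonneg (z.2 - w.2)]
    refine Prod.ext ?_ ?_
    · exact sub_eq_zero.1 (norm_eq_zero.1 (pow_eq_zero_iff two_ne_zero |>.1 h4))
    · exact sub_eq_zero.1 (pow_eq_zero_iff two_ne_zero |>.1 h5)
  subst hzw'
  have hzD : z ∈ D := hzw.1
  have hD_within : ∀ f : ℕ → E × ℝ, (∀ n, f n ∈ D) → Filter.Tendsto f Filter.atTop (𝓝 z) →
      Filter.Tendsto f Filter.atTop (𝓝[D] z) := fun f hf h =>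
    tendsto_nhdsWithin_iff.2 ⟨h, Filter.Eventually.of_forall hf⟩
  have hul : Filter.Tendsto (fun n => u (q (φ n)).1.1 (q (φ n)).1.2) Filter.atTop
      (𝓝 (u z.1 z.2)) :=
    (hucD z hzD).tendsto.comp (hD_within _ (fun n => (hqD _).1) hlz)
  have hvl1 : Filter.Tendsto (fun n => v (q (φ n)).1.1 (q (φ n)).1.2) Filter.atTop
      (𝓝 (v z.1 z.2)) :=
    (hvcD z hzD).tendsto.comp (hD_within _ (fun n => (hqD _).1) hlz)
  have hvl2 : Filter.Tendsto (fun n => v (q (φ n)).2.1 (q (φ n)).2.2) Filter.atTop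
      (𝓝 (v z.1 z.2)) :=
    (hvcD z hzD).tendsto.comp (hD_within _ (fun n => (hqD _).2) hlw)
  have hzval : m / 4 ≤ u z.1 z.2 - v z.1 z.2 - χ z := by
    have h1 := (hul.sub hvl2).sub ((hχ.continuous.tendsto z).comp hlz)
    refine ge_of_tendsto' h1 fun n => ?_
    have h2 := hlow (φ n)
    have h3 : 0 ≤ ((φ n : ℕ) : ℝ) * d (φ n) := mul_nonneg (Nat.cast_nonneg _) (hd0 _)
    have h4 : 0 ≤ l * (q (φ n)).1.2 := mul_nonneg hl0.le (hqD (φ n)).1.2.1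
    simp only [hΦ] at h2
    simp only [hd] at h3
    simp only [Function.comp_apply]
    linarith
  -- The limit is interior: the initial data exclude time `0`, and the barrier excludes the lateral
  -- and terminal boundary.
  have hzO : z ∈ Metric.ball (0 : E) R ×ˢ Ioo 0 S := by
    have h1 : z.2 ≠ 0 := by
      intro h
      have := h0 z.1
      have := hχ0 z
      rw [h] at hzval
      linarith
    have h2 : ¬ (R ≤ ‖z.1‖ ∨ S ≤ z.2) := by
      intro h
      have := hχB z.1 z.2 hzD.2.1 h
      have := hB z hzD z hzD
      rw [Prod.mk.eta] at *
      linarith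
    push Not at h2
    exact ⟨by simpa using h2.1, lt_of_le_of_ne hzD.2.1 (Ne.symm h1), h2.2⟩
  have hO : IsOpen (Metric.ball (0 : E) R ×ˢ Ioo 0 S) := Metric.isOpen_ball.prod isOpen_Ioo
  have hOD : Metric.ball (0 : E) R ×ˢ Ioo 0 S ⊆ D :=
    prod_mono Metric.ball_subset_closedBall Ioo_subset_Icc_self
  have hsmall : Filter.Tendsto (fun n => |κ| * (2 * (v (q (φ n)).1.1 (q (φ n)).1.2
      - v (q (φ n)).2.1 (q (φ n)).2.2))) Filter.atTop (𝓝 0) := by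
    simpa using ((hvl1.sub hvl2).const_mul 2).const_mul |κ|
  obtain ⟨n, hn1, hn2, hn3⟩ := ((hlz.eventually (hO.mem_nhds hzO)).and
    ((hlw.eventually (hO.mem_nhds hzO)).and (hsmall.eventually (gt_mem_nhds hl0)))).exists
  generalize φ n = k at hn1 hn2 hn3
  have hle := slope_le_of_doubled_isLocalMax hHp hHx hu hv hc hχ (l := l) (k := (k : ℝ))
    (Nat.cast_nonneg k) (z := (q k).1) (w := (q k).2) (hχN _)
    ⟨hn1.2.1, hn1.2.2.trans hS2⟩ ⟨hn2.2.1, hn2.2.2.trans hS2⟩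
    (by
      filter_upwards [hO.mem_nhds hn1] with z' hz'
      exact hqmax k (show (z', (q k).2) ∈ D ×ˢ D from ⟨hOD hz', (hqD k).2⟩))
    (by
      filter_upwards [hO.mem_nhds hn2] with z' hz'
      exact hqmax k (show ((q k).1, z') ∈ D ×ˢ D from ⟨(hqD k).1, hOD hz'⟩))
  -- Comparison with the diagonal point bounds the penalty by an increment of `v`, which tends to
  -- `0`; this contradicts the positive slope `l`.
  have hdiag : (k : ℝ) * ‖(q k).1.1 - (q k).2.1‖ ^ 2
      ≤ v (q k).1.1 (q k).1.2 - v (q k).2.1 (q k).2.2 := by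
    have h1 := hqmax k (show ((q k).1, (q k).1) ∈ D ×ˢ D from ⟨(hqD k).1, (hqD k).1⟩)
    simp only [hΦ] at h1
    have h2 : 0 ≤ (k : ℝ) * ((q k).1.2 - (q k).2.2) ^ 2 := by positivity
    norm_num at h1
    linarith
  have hκ : κ * (2 * ((k : ℝ) * ‖(q k).1.1 - (q k).2.1‖ ^ 2))
      ≤ |κ| * (2 * (v (q k).1.1 (q k).1.2 - v (q k).2.1 (q k).2.2)) := by
    refine (mul_le_mul_of_nonneg_right (le_abs_self κ) (by positivity)).trans ?_
    exact mul_le_mul_of_nonneg_left (by linarith) (abs_nonneg κ)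
  linarith

/-- Comparison principle on `E × [0, T]`, without growth assumptions at infinity. -/
theorem comparison (hc : 0 ≤ c)
    (hHp : ∀ s x p q, H s x p ≤ H s x q + c * (1 + ‖x‖) * ‖p - q‖)
    (hHx : ∀ s t x y p, H s x p ≤ H t y p + κ * ‖x - y‖ * ‖p‖)
    (hu : IsViscositySubsolution T H u) (hv : IsViscositySupersolution T H v)
    (huc : ContinuousOn (fun z : E × ℝ => u z.1 z.2) (univ ×ˢ Icc 0 T))
    (hvc : ContinuousOn (fun z : E × ℝ => v z.1 z.2) (univ ×ˢ Icc 0 T))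
    (h0 : ∀ x, u x 0 ≤ v x 0) (hT : 0 < T) (x : E) {s : ℝ} (hs : s ∈ Icc 0 T) :
    u x s ≤ v x s := by
  have hline : ContinuousOn (fun r : ℝ => ((x, r) : E × ℝ)) (Icc 0 T) := by fun_prop
  have hmaps : MapsTo (fun r : ℝ => ((x, r) : E × ℝ)) (Icc 0 T) (univ ×ˢ Icc 0 T) :=
    fun r hr => ⟨mem_univ _, hr⟩
  have h1 : ContinuousOn (fun r => u x r) (Icc 0 T) := huc.comp hline hmaps
  have h2 : ContinuousOn (fun r => v x r) (Icc 0 T) := hvc.comp hline hmaps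
  -- The equation gives the inequality on the open interval; continuity carries it to the endpoints.
  have hcl : s ∈ closure (Ioo 0 T) := by rwa [closure_Ioo hT.ne]
  exact ((h1 s hs).mono Ioo_subset_Icc_self).closure_le hcl
    ((h2 s hs).mono Ioo_subset_Icc_self)
    fun r hr => comparison_of_mem_Ioo hc hHp hHx hu hv huc hvc h0 x hr

variable {A : E →L[ℝ] E} {C : Set E} {g : E → ℝ}

/-- A supremum over controls bounded by `R` has the structure that comparison needs, with constants
`‖A‖ + R` in `p` and `‖A‖` in `x`. -/
theorem IsControlHamiltonian.eq_of_isViscositySolution (hH : IsControlHamiltonian A C H)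
    (hT : 0 < T) (hu : IsViscositySolution T H g u) (hv : IsViscositySolution T H g v) (x : E)
    {s : ℝ} (hs : s ∈ Icc 0 T) : u x s = v x s := by
  obtain ⟨R, hR⟩ := hH.bounded
  obtain ⟨c₀, hc₀⟩ := hH.nonempty
  have hR0 : 0 ≤ R := (norm_nonneg _).trans (hR c₀ hc₀)
  have hHp : ∀ s x p q, H s x p ≤ H s x q + (‖A‖ + R) * (1 + ‖x‖) * ‖p - q‖ := by
    intro s x p q
    refine (hH.isLUB s x p).2 ?_
    rintro _ ⟨c, hc, rfl⟩
    have h1 := (hH.isLUB s x q).1 ⟨c, hc, rfl⟩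
    have h2 : -⟪A x + c, p - q⟫_ℝ ≤ (‖A‖ + R) * (1 + ‖x‖) * ‖p - q‖ := by
      refine (neg_le_abs _).trans ((abs_real_inner_le_norm _ _).trans ?_)
      refine mul_le_mul_of_nonneg_right ?_ (norm_nonneg _)
      refine (norm_add_le _ _).trans ((add_le_add (A.le_opNorm x) (hR c hc)).trans ?_)
      nlinarith [norm_nonneg A, norm_nonneg x, mul_nonneg hR0 (norm_nonneg x)]
    rw [inner_sub_right] at h2
    dsimp only at h1 ⊢
    linarith
  have hHx : ∀ s t x y p, H s x p ≤ H t y p + ‖A‖ * ‖x - y‖ * ‖p‖ := by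
    intro s t x y p
    refine (hH.isLUB s x p).2 ?_
    rintro _ ⟨c, hc, rfl⟩
    have h1 := (hH.isLUB t y p).1 ⟨c, hc, rfl⟩
    have h2 : -⟪A (x - y), p⟫_ℝ ≤ ‖A‖ * ‖x - y‖ * ‖p‖ :=
      (neg_le_abs _).trans ((abs_real_inner_le_norm _ _).trans
        (mul_le_mul_of_nonneg_right (A.le_opNorm _) (norm_nonneg _)))
    rw [map_sub, inner_sub_left] at h2
    simp only [inner_add_left] at h1 ⊢
    linarith
  have hc : 0 ≤ ‖A‖ + R := by positivity
  refine le_antisymm ?_ ?_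
  · exact comparison hc hHp hHx hu.subsolution hv.supersolution hu.continuousOn hv.continuousOn
      (fun x => by rw [hu.initial, hv.initial]) hT x hs
  · exact comparison hc hHp hHx hv.subsolution hu.supersolution hv.continuousOn hu.continuousOn
      (fun x => by rw [hu.initial, hv.initial]) hT x hs

theorem IsControlHamiltonian.isUniqueViscositySolution (hH : IsControlHamiltonian A C H)
    (hT : 0 < T) (hu : IsViscositySolution T H g u) : IsUniqueViscositySolution T H g u :=
  ⟨hu, fun _ hv x _ hs => hH.eq_of_isViscositySolution hT hv hu x hs⟩

end Uniqueness

/-! ### Independence of the values outside `[0, T]`. -/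

section Congruence

variable {E : Type*} [NormedAddCommGroup E] [InnerProductSpace ℝ E] [CompleteSpace E]

/-- Being a viscosity solution depends only on the values on `E × [0, T]`. -/
theorem IsViscositySolution.congr {H : ℝ → E → E → ℝ} {T : ℝ} {g : E → ℝ} {u v : E → ℝ → ℝ}
    (hT : 0 ≤ T) (hu : IsViscositySolution T H g u) (h : ∀ x, ∀ s ∈ Icc 0 T, v x s = u x s) :
    IsViscositySolution T H g v := by
  have hev : ∀ (ψ : E → ℝ → ℝ) (x : E), ∀ s ∈ Ioo 0 T,
      (fun z : E × ℝ => v z.1 z.2 - ψ z.1 z.2) =ᶠ[𝓝 (x, s)]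
        fun z : E × ℝ => u z.1 z.2 - ψ z.1 z.2 := by
    intro ψ x s hs
    have hnhds : univ ×ˢ Ioo 0 T ∈ 𝓝 (x, s) :=
      (isOpen_univ.prod isOpen_Ioo).mem_nhds ⟨mem_univ x, hs⟩
    filter_upwards [hnhds] with z hz
    rw [h z.1 z.2 (Ioo_subset_Icc_self hz.2)]
  refine ⟨hu.continuousOn.congr fun z hz => h z.1 z.2 hz.2, fun x => ?_, ?_, ?_⟩
  · rw [h x 0 ⟨le_rfl, hT⟩, hu.initial]
  · intro ψ hψ x s hs hmax
    exact hu.subsolution ψ hψ x s hs ((hev ψ x s hs).isLocalMax_iff.1 hmax)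
  · intro ψ hψ x s hs hmin
    exact hu.supersolution ψ hψ x s hs ((hev ψ x s hs).isLocalMin_iff.1 hmin)

end Congruence

/-! ### Vehicles and the joint system -/

section Vehicles

theorem isControlHamiltonian_vehicleHamiltonian {n m : ℕ} {A : Matrix (Fin n) (Fin n) ℝ}
    {B : Matrix (Fin n) (Fin m) ℝ} {𝒜 : Set (EuclideanSpace ℝ (Fin m))} {T : ℝ} (hT : 0 ≤ T)
    (hfin : ∀ x p, vehicleHamiltonianE A B 𝒜 x p ≠ ⊥ ∧ vehicleHamiltonianE A B 𝒜 x p ≠ ⊤)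
    (hreg : RegularHamiltonian T (vehicleHamiltonian A B 𝒜)) :
    IsControlHamiltonian A.toEuclideanLin.toContinuousLinearMap (B.toEuclideanLin '' 𝒜)
      (vehicleHamiltonian A B 𝒜) := by
  have hlub : ∀ (s : ℝ) (x p : EuclideanSpace ℝ (Fin n)), IsLUB
      ((fun c => -⟪A.toEuclideanLin.toContinuousLinearMap x + c, p⟫_ℝ) '' (B.toEuclideanLin '' 𝒜))
      (vehicleHamiltonian A B 𝒜 s x p) := by
    intro s x p
    obtain ⟨h1, h2⟩ := hfin x p
    have h3 : vehicleHamiltonianE A B 𝒜 x p = ((-⟪A.toEuclideanLin x, p⟫_ℝ : ℝ) : EReal) +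
      ⨆ α : EuclideanSpace ℝ (Fin m), (((⟪-B.toEuclideanLin α, p⟫_ℝ : ℝ) : EReal) - charFn 𝒜 α) :=
      rfl
    obtain ⟨S, hS⟩ : ∃ S : EReal,
      S = ⨆ α : EuclideanSpace ℝ (Fin m),
        (((⟪-B.toEuclideanLin α, p⟫_ℝ : ℝ) : EReal) - charFn 𝒜 α) := ⟨_, rfl⟩
    rw [← hS] at h3
    have hSbot : S ≠ ⊥ := by
      rintro rfl
      simp [h3] at h1
    have hStop : S ≠ ⊤ := by
      rintro rfl
      simp [h3] at h2
    lift S to ℝ using ⟨hStop, hSbot⟩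
    have h4 : vehicleHamiltonian A B 𝒜 s x p = -⟪A.toEuclideanLin x, p⟫_ℝ + S := by
      rw [vehicleHamiltonian, h3, ← EReal.coe_add, EReal.toReal_coe]
    rw [h4]
    constructor
    · rintro _ ⟨_, ⟨α, hα, rfl⟩, rfl⟩
      have h5 : (((⟪-B.toEuclideanLin α, p⟫_ℝ : ℝ) : EReal) - charFn 𝒜 α) ≤ S := by
        rw [hS]
        exact le_iSup (fun α => ((⟪-B.toEuclideanLin α, p⟫_ℝ : ℝ) : EReal) - charFn 𝒜 α) α
      rw [charFn, if_pos hα, sub_zero, EReal.coe_le_coe_iff, inner_neg_left] at h5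
      simp only [inner_add_left, LinearMap.coe_toContinuousLinearMap']
      linarith
    · intro M hM
      have h5 : (S : EReal) ≤ ((M + ⟪A.toEuclideanLin x, p⟫_ℝ : ℝ) : EReal) := by
        rw [hS]
        refine iSup_le fun α => ?_
        by_cases hα : α ∈ 𝒜
        · rw [charFn, if_pos hα, sub_zero, EReal.coe_le_coe_iff, inner_neg_left]
          have h6 := hM ⟨_, ⟨α, hα, rfl⟩, rfl⟩
          simp only [inner_add_left, LinearMap.coe_toContinuousLinearMap'] at h6
          linarith
        · simp [charFn, if_neg hα]
      rw [EReal.coe_le_coe_iff] at h5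
      linarith
  obtain ⟨c, hc, hgr⟩ := hreg.growth
  refine ⟨?_, ⟨c, ?_⟩, hlub⟩
  -- A supremum over the empty set would be a least real number.
  · by_contra! h
    have := hlub 0 0 0
    rw [h, image_empty, isLUB_empty_iff] at this
    exact not_isBot _ this
  -- Growth in `p` is tested at `s = 0`, `x = 0`, `p = -b`: there `‖b‖² ≤ H ≤ c ‖b‖`.
  · intro b hb
    have h1 := (hgr 0 ⟨le_rfl, hT⟩ 0).1 (-b) 0
    have h2 := (hlub 0 0 (-b)).1 ⟨b, hb, rfl⟩
    have h3 : vehicleHamiltonian A B 𝒜 0 0 0 ≤ 0 := by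
      refine (hlub 0 0 0).2 ?_
      rintro _ ⟨_, -, rfl⟩
      simp
    have h4 := (abs_le.1 h1).2
    simp only [map_zero, zero_add, inner_neg_right, neg_neg, real_inner_self_eq_norm_sq] at h2
    simp only [norm_zero, add_zero, mul_one, sub_zero, norm_neg] at h4
    rcases (norm_nonneg b).eq_or_lt with h | h
    · rw [← h]; exact hc.le
    · refine le_of_mul_le_mul_right ?_ h
      nlinarith

/-! ### The joint system as a control system. -/

variable {N : ℕ} {n : Fin N → ℕ}

/-- The linear field on the joint space that acts on each component separately. -/
def jointField (A : ∀ i, EuclideanSpace ℝ (Fin (n i)) →L[ℝ] EuclideanSpace ℝ (Fin (n i))) :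
    JointSpace n →L[ℝ] JointSpace n :=
  LinearMap.toContinuousLinearMap
    { toFun := fun x => WithLp.toLp 2 fun i => A i (x i)
      map_add' := fun x y => by ext1 i; simp
      map_smul' := fun a x => by ext1 i; simp }

/-- The product of the control sets of the vehicles. -/
def jointControlSet (C : ∀ i, Set (EuclideanSpace ℝ (Fin (n i)))) : Set (JointSpace n) :=
  {c | ∀ i, c i ∈ C i}

variable {A : ∀ i, EuclideanSpace ℝ (Fin (n i)) →L[ℝ] EuclideanSpace ℝ (Fin (n i))}
  {C : ∀ i, Set (EuclideanSpace ℝ (Fin (n i)))}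
  {H : ∀ i, ℝ → EuclideanSpace ℝ (Fin (n i)) → EuclideanSpace ℝ (Fin (n i)) → ℝ}

/-- Over a product of control sets, the supremum of a sum of terms in separate variables is the sum
of the suprema. -/
theorem isControlHamiltonian_jointHamiltonian
    (hH : ∀ i, IsControlHamiltonian (A i) (C i) (H i)) :
    IsControlHamiltonian (jointField A) (jointControlSet C) (jointHamiltonian H) := by
  refine ⟨?_, ?_, fun s x p => ⟨?_, ?_⟩⟩
  · choose c hc using fun i => (hH i).nonempty
    exact ⟨WithLp.toLp 2 c, hc⟩
  · choose R hR using fun i => (hH i).bounded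
    refine ⟨√(∑ i, R i ^ 2), fun c hc => ?_⟩
    rw [PiLp.norm_eq_of_L2]
    refine Real.sqrt_le_sqrt (Finset.sum_le_sum fun i _ => ?_)
    exact pow_le_pow_left₀ (norm_nonneg _) (hR i _ (hc i)) 2
  · rintro _ ⟨c, hc, rfl⟩
    dsimp only
    rw [PiLp.inner_apply, ← Finset.sum_neg_distrib]
    exact Finset.sum_le_sum fun i _ => ((hH i).isLUB s (x i) (p i)).1 ⟨c i, hc i, rfl⟩
  · intro M hM
    refine le_of_forall_pos_le_add fun ε hε => ?_
    -- The denominator `N + 1` also covers `N = 0`, which is not excluded here.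
    have hδ : 0 < ε / (N + 1) := by positivity
    have hex : ∀ i, ∃ c ∈ C i, H i s (x i) (p i) - ε / (N + 1) < -⟪A i (x i) + c, p i⟫_ℝ := by
      intro i
      obtain ⟨_, ⟨c, hc, rfl⟩, h, -⟩ := ((hH i).isLUB s (x i) (p i)).exists_between
        (sub_lt_self (H i s (x i) (p i)) hδ)
      exact ⟨c, hc, h⟩
    choose c hc hlt using hex
    have h1 := hM ⟨WithLp.toLp 2 c, hc, rfl⟩
    dsimp only at h1
    rw [PiLp.inner_apply, ← Finset.sum_neg_distrib] at h1
    have h2 : ∑ i, (H i s (x i) (p i) - ε / (N + 1)) ≤ ∑ i, -⟪A i (x i) + c i, p i⟫_ℝ :=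
      Finset.sum_le_sum fun i _ => (hlt i).le
    have h3 : (N : ℝ) * (ε / (N + 1)) ≤ ε := by
      rw [mul_div_assoc', div_le_iff₀ (by positivity)]
      nlinarith
    rw [Finset.sum_sub_distrib, Finset.sum_const, Finset.card_univ, Fintype.card_fin,
      nsmul_eq_mul] at h2
    have h4 : ∑ i, -⟪A i (x i) + c i, p i⟫_ℝ ≤ M := h1
    change ∑ i, H i s (x i) (p i) ≤ M + ε
    linarith

theorem controls_apply {b : ℝ → JointSpace n} (hb : b ∈ controls (jointControlSet C)) (i : Fin N) :
    (fun r => b r i) ∈ controls (C i) :=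
  ⟨(PiLp.proj (𝕜 := ℝ) 2 (fun i => EuclideanSpace ℝ (Fin (n i)))
    i).continuous.comp_stronglyMeasurable hb.1, fun r => hb.2 r i⟩

theorem controls_toLp {b : ∀ i, ℝ → EuclideanSpace ℝ (Fin (n i))}
    (hb : ∀ i, b i ∈ controls (C i)) :
    (fun r => WithLp.toLp 2 fun i => b i r) ∈ controls (jointControlSet C) := by
  refine ⟨?_, fun r i => (hb i).2 r⟩
  refine (PiLp.continuous_toLp 2 _).comp_stronglyMeasurable ?_
  exact (measurable_pi_lambda _ fun i => (hb i).1.measurable).stronglyMeasurable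

theorem trajectory_jointField_apply {R : ℝ} (hR : ∀ c ∈ jointControlSet C, ‖c‖ ≤ R)
    {b : ℝ → JointSpace n} (hb : b ∈ controls (jointControlSet C)) (x : JointSpace n) (t : ℝ)
    (i : Fin N) :
    trajectory (jointField A) b x t i = trajectory (A i) (fun r => b r i) (x i) t :=
  trajectory_intertwine (B := A i)
    (PiLp.proj (𝕜 := ℝ) 2 (fun i => EuclideanSpace ℝ (Fin (n i))) i) (fun _ => rfl) hR hb x t

/-! ### The bottleneck and its value function. -/

variable [NeZero N]

theorem bottleneck_le_iff {c : Fin N → Fin N → ℝ} {a : ℝ} :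
    bottleneck c ≤ a ↔ ∃ σ : Equiv.Perm (Fin N), ∀ i, c i (σ i) ≤ a := by
  simp [bottleneck, Finset.inf'_le_iff, Finset.sup'_le_iff]

theorem bottleneck_mono {c d : Fin N → Fin N → ℝ} (h : ∀ i j, c i j ≤ d i j) :
    bottleneck c ≤ bottleneck d := by
  obtain ⟨σ, hσ⟩ := bottleneck_le_iff.1 (le_refl (bottleneck d))
  exact bottleneck_le_iff.2 ⟨σ, fun i => (h i (σ i)).trans (hσ i)⟩

theorem continuous_bottleneck {X : Type*} [TopologicalSpace X] {c : X → Fin N → Fin N → ℝ}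
    (h : ∀ i j, Continuous fun x => c x i j) : Continuous fun x => bottleneck (c x) := by
  unfold bottleneck
  exact Continuous.finset_inf'_apply _ fun σ _ =>
    Continuous.finset_sup'_apply _ fun i _ => h i (σ i)

/-- The controls of the vehicles being independent, the joint value of a bottleneck cost is the
bottleneck of the individual values. -/
theorem valueFunction_bottleneck (hH : ∀ i, IsControlHamiltonian (A i) (C i) (H i))
    {g : ∀ i : Fin N, Fin N → EuclideanSpace ℝ (Fin (n i)) → ℝ} (hg : ∀ i j, Continuous (g i j))
    (x : JointSpace n) {s : ℝ} (hs : 0 ≤ s) :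
    valueFunction (jointField A) (jointControlSet C)
        (fun x => bottleneck fun i j => g i j (x i)) x s =
      bottleneck fun i j => valueFunction (A i) (C i) (g i j) (x i) s := by
  have hJ := isControlHamiltonian_jointHamiltonian hH
  obtain ⟨R, hR⟩ := hJ.bounded
  have hJc : Continuous fun x : JointSpace n => bottleneck fun i j => g i j (x i) :=
    continuous_bottleneck fun i j => (hg i j).comp
      (PiLp.proj (𝕜 := ℝ) 2 (fun i => EuclideanSpace ℝ (Fin (n i))) i).continuous
  refine le_antisymm ?_ ?_
  -- An assignment optimal for the individual values is fixed first; each vehicle then runs an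
  -- almost optimal control for its assigned goal.
  · obtain ⟨σ, hσ⟩ := bottleneck_le_iff.1
      (le_refl (bottleneck fun i j => valueFunction (A i) (C i) (g i j) (x i) s))
    refine le_of_forall_pos_le_add fun ε hε => ?_
    choose b hb hlt using fun i =>
      exists_cost_lt (A := A i) (g := g i (σ i)) (hH i).nonempty (x := x i) (s := s) hε
    refine (valueFunction_le hR hJc x hs (controls_toLp hb)).trans ?_
    refine bottleneck_le_iff.2 ⟨σ, fun i => ?_⟩
    rw [trajectory_jointField_apply hR (controls_toLp hb)]
    exact (hlt i).le.trans (by linarith [hσ i])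
  -- Conversely the components of any joint control are admissible individually, so its cost matrix
  -- dominates the matrix of values.
  · refine le_valueFunction hJ.nonempty fun b hb => bottleneck_mono fun i j => ?_
    obtain ⟨Ri, hRi⟩ := (hH i).bounded
    rw [trajectory_jointField_apply hR hb]
    exact valueFunction_le hRi (hg i j) (x i) hs (controls_apply hb i)

end Vehicles

end

theorem theorem1 (N : ℕ) [NeZero N] (n m : Fin N → ℕ)
    -- dynamics and convex control sets
    (A : ∀ i, Matrix (Fin (n i)) (Fin (n i)) ℝ) (B : ∀ i, Matrix (Fin (n i)) (Fin (m i)) ℝ)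
    (𝒜 : ∀ i, Set (EuclideanSpace ℝ (Fin (m i)))) (h𝒜 : ∀ i, Convex ℝ (𝒜 i))
    -- goal sets and their implicit representations
    (Ω : ∀ i : Fin N, Fin N → Set (EuclideanSpace ℝ (Fin (n i))))
    (g : ∀ i : Fin N, Fin N → EuclideanSpace ℝ (Fin (n i)) → ℝ)
    (hg : ∀ i j, Ω i j = {x | g i j x ≤ 0})
    (T : ℝ) (hT : 0 < T)
    -- the Hamiltonians are real-valued and satisfy the regularity assumptions
    (hfin : ∀ i x p, vehicleHamiltonianE (A i) (B i) (𝒜 i) x p ≠ ⊥ ∧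
      vehicleHamiltonianE (A i) (B i) (𝒜 i) x p ≠ ⊤)
    (hreg : ∀ i, RegularHamiltonian T (vehicleHamiltonian (A i) (B i) (𝒜 i)))
    (hcont : ∀ i j, Continuous (g i j)) :
    (∀ i j, ∃ φ : EuclideanSpace ℝ (Fin (n i)) → ℝ → ℝ,
      IsUniqueViscositySolution T (vehicleHamiltonian (A i) (B i) (𝒜 i)) (g i j) φ) ∧
    ∃ J : JointSpace n → ℝ,
      (∀ x, J x = bottleneck fun i j => g i j (x i)) ∧
      goalSet Ω = {x | J x ≤ 0} ∧
      ∀ φ : ∀ i : Fin N, Fin N → EuclideanSpace ℝ (Fin (n i)) → ℝ → ℝ,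
        (∀ i j, IsViscositySolution T (vehicleHamiltonian (A i) (B i) (𝒜 i)) (g i j) (φ i j)) →
        IsUniqueViscositySolution T
          (jointHamiltonian fun i => vehicleHamiltonian (A i) (B i) (𝒜 i)) J
          (fun x s => bottleneck fun i j => φ i j (x i) s) := by
  have hH := fun i => isControlHamiltonian_vehicleHamiltonian hT.le (hfin i) (hreg i)
  have hJ := isControlHamiltonian_jointHamiltonian hH
  refine ⟨fun i j => ⟨_, (hH i).isUniqueViscositySolution hT
    ((hH i).isViscositySolution_valueFunction (hcont i j) T)⟩,
    fun x => bottleneck fun i j => g i j (x i), fun _ => rfl, ?_, fun φ hφ => ?_⟩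
  · ext x
    simp only [goalSet, hg, mem_ofPred_eq, bottleneck_le_iff]
  · have hJc : Continuous fun x : JointSpace n => bottleneck fun i j => g i j (x i) :=
      continuous_bottleneck fun i j => (hcont i j).comp
        (PiLp.proj (𝕜 := ℝ) 2 (fun i => EuclideanSpace ℝ (Fin (n i))) i).continuous
    -- Uniqueness for each vehicle identifies the given `φ i j` with the values on `[0, T]` only,
    -- hence the passage through `congr`.
    refine hJ.isUniqueViscositySolution hT
      ((hJ.isViscositySolution_valueFunction hJc T).congr hT.le fun x s hs => ?_)
    rw [valueFunction_bottleneck hH hcont x hs.1]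
    congr 1
    funext i j
    exact (hH i).eq_of_isViscositySolution hT (hφ i j)
      ((hH i).isViscositySolution_valueFunction (hcont i j) T) (x i) hs
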